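/- **Theorem.** For a finite set $P\subset\mathbb R^d$ and a tuple $S=(s_1,\dots,s_k)$ of $k\ge 1$ centers in $\mathbb R^d$ write $\mathrm{cost}(p,S)=\min_i\|p-s_i\|_2$, $\mathrm{cost}(P,S)=\sum_{p\in P}\mathrm{cost}(p,S)$, and $\mathrm{OPT}_k=\inf_{S}\mathrm{cost}(P,S)$ over all $k$-tuples $S$ (with $\mathrm{OPT}_0=+\infty$). The set $P$ is *$\beta$-stable* for the $k$-median objective if $(1+\beta)\,\mathrm{OPT}_k\le \mathrm{OPT}_{k-1}$. Points $q_1,\dots,q_m\in\mathbb R^d$ (repetitions allowed) with weights $w_1,\dots,w_m$ form an *$\varepsilon$-coreset* of $P$ if for every $k$-tuple $S$ of centers $$(1-\varepsilon)\,\mathrm{cost}(P,S)\ \le\ \sum_{i=1}^m w_i\,\mathrm{cost}(q_i,S)\ \le\ (1+\varepsilon)\,\mathrm{cost}(P,S).$$ *Sensitivity Sampling* with $m$ samples, started from a $\gamma$-approximate $k$-median solution $A=(a_1,\dots,a_k)$, i.e. $\mathrm{cost}(P,A)\le\gamma\,\mathrm{OPT}_k$, does the following. Partition $P$ into clusters $C_1,\dots,C_k$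 by assigning every point to a nearest center of $A$ (ties broken arbitrarily). Let $\mu$ be the probability distribution on $P$ given, for $p\in C_j$, by $$\mu(p)=\frac14\left(\frac1{k|C_j|}+\frac{\mathrm{cost}(p,A)}{k\,\mathrm{cost}(C_j,A)}+\frac{\mathrm{cost}(p,A)}{\mathrm{cost}(P,A)}+\frac{\Delta_p}{\mathrm{cost}(P,A)}\right),\qquad \Delta_p=\frac{\mathrm{cost}(C_j,A)}{|C_j|},$$ where, if some cluster is empty or has cost $0$, one reads $0/0=0$ and divides the right-hand side by its sum over $P$. Draw $q_1,\dots,q_m$ independently from $\mu$ and give $q_i$ the weight $w_i=1/(m\,\mu(q_i))$. Then for every $\gamma\ge1$ there are constants $C>0$ and $c\in\mathbb N$, depending only on $\gamma$, such that the following holds. Let $d\ge 0$ and $k\ge1$ be integers, let $\beta>0$ and $0<\varepsilon<1$, let $P\subset\mathbb R^d$ be a non-empty finite set that is $\beta$-stable for the $k$-median objective, and let $A$ be a $\gamma$-approximate $k$-median solution for $P$. If $$m\ \ge\ C\,\frac{k}{\varepsilon^{2}}\,\max(1,\beta^{-1})\,\bigl(1+\log(k/\varepsilon)\bigr)^{c},$$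 then with probability at least $2/3$ the weighted points produced by Sensitivity Sampling with $m$ samples form an $\varepsilon$-coreset of $P$. -/

import Mathlib

open MeasureTheory

namespace KMedian

noncomputable section

/-- `d`-dimensional Euclidean space. -/
abbrev Pt (d : ℕ) : Type := EuclideanSpace ℝ (Fin d)

/-- `cost(p, S)`: the distance of `p` to the nearest of the `k` centers `S` (used for `k ≥ 1`). -/
def ptCost {d k : ℕ} (p : Pt d) (S : Fin k → Pt d) : ℝ := ⨅ i, dist p (S i)

/-- `cost(P, S)`: the `k`-median cost of the finite set `P` with respect to the centers `S`. -/
def cost {d k : ℕ} (P : Finset (Pt d)) (S : Fin k → Pt d) : ℝ := ∑ p ∈ P, ptCost p S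

/-- `OPT_k`: the optimal `k`-median cost of `P` (used for `k ≥ 1`). -/
def opt {d : ℕ} (P : Finset (Pt d)) (k : ℕ) : ℝ := ⨅ S : Fin k → Pt d, cost P S

/-- `P` is `β`-stable for the `k`-median objective: `(1 + β) OPT_k ≤ OPT_{k-1}`. For `k = 1` there
is no solution with `k - 1` centers, `OPT_0 = +∞`, and the inequality holds. -/
def IsStable {d : ℕ} (P : Finset (Pt d)) (k : ℕ) (β : ℝ) : Prop :=
  2 ≤ k → opt P k * (1 + β) ≤ opt P (k - 1)

/-- `A` is a `γ`-approximate `k`-median solution for `P`. -/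
def IsApprox {d k : ℕ} (γ : ℝ) (P : Finset (Pt d)) (A : Fin k → Pt d) : Prop :=
  cost P A ≤ γ * opt P k

/-- `σ` assigns every point of `P` to a nearest center of `A` (ties broken arbitrarily). -/
def IsNearest {d k : ℕ} (P : Finset (Pt d)) (A : Fin k → Pt d) (σ : Pt d → Fin k) : Prop :=
  ∀ p ∈ P, ∀ i, dist p (A (σ p)) ≤ dist p (A i)

/-- The cluster `C_j`: the points of `P` that are assigned to the `j`-th center. -/
def cluster {d k : ℕ} (P : Finset (Pt d)) (σ : Pt d → Fin k) (j : Fin k) : Finset (Pt d) :=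
  P.filter fun p => σ p = j

/-- `Δ_p = cost(C_j, A) / |C_j|`, the average cost of the cluster `C_j` that contains `p`. -/
def avgCost {d k : ℕ} (P : Finset (Pt d)) (A : Fin k → Pt d) (σ : Pt d → Fin k) (p : Pt d) : ℝ :=
  cost (cluster P σ (σ p)) A / ((cluster P σ (σ p)).card : ℝ)

/-- The sampling scores of Sensitivity Sampling, with `0 / 0 = 0`. They sum to `1` over `P` if every
cluster is non-empty and has positive cost. -/
def score {d k : ℕ} (P : Finset (Pt d)) (A : Fin k → Pt d) (σ : Pt d → Fin k) (p : Pt d) : ℝ :=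
  1 / 4 * (1 / ((k : ℝ) * ((cluster P σ (σ p)).card : ℝ))
    + ptCost p A / ((k : ℝ) * cost (cluster P σ (σ p)) A)
    + ptCost p A / cost P A
    + avgCost P A σ p / cost P A)

/-- The sampling probability `μ(p)`: the score, divided by the sum of all scores (that sum is `1`
unless some cluster is empty or has cost `0`). -/
def mu {d k : ℕ} (P : Finset (Pt d)) (A : Fin k → Pt d) (σ : Pt d → Fin k) (p : Pt d) : ℝ :=
  score P A σ p / ∑ x ∈ P, score P A σ x

theorem ptCost_nonneg {d k : ℕ} (p : Pt d) (S : Fin k → Pt d) : 0 ≤ ptCost p S :=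
  Real.iInf_nonneg fun _ => dist_nonneg

theorem cost_nonneg {d k : ℕ} (P : Finset (Pt d)) (S : Fin k → Pt d) : 0 ≤ cost P S :=
  Finset.sum_nonneg fun p _ => ptCost_nonneg p S

theorem score_pos {d k : ℕ} (P : Finset (Pt d)) (A : Fin k → Pt d) (σ : Pt d → Fin k) (p : Pt d)
    (hp : p ∈ P) : 0 < score P A σ p := by
  have hk : (0 : ℝ) < k := by exact_mod_cast (σ p).pos
  have hc : (0 : ℝ) < ((cluster P σ (σ p)).card : ℝ) := by
    have : p ∈ cluster P σ (σ p) := by simp [cluster, hp]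
    exact_mod_cast Finset.card_pos.mpr ⟨p, this⟩
  have h1 := ptCost_nonneg p A
  have h2 := cost_nonneg P A
  have h3 := cost_nonneg (cluster P σ (σ p)) A
  have h4 : 0 ≤ avgCost P A σ p := div_nonneg h3 hc.le
  unfold score
  positivity

theorem sum_ofReal_mu {d k : ℕ} (P : Finset (Pt d)) (hP : P.Nonempty) (A : Fin k → Pt d)
    (σ : Pt d → Fin k) : ∑ p : {x // x ∈ P}, ENNReal.ofReal (mu P A σ p) = 1 := by
  have hpos : 0 < ∑ x ∈ P, score P A σ x := Finset.sum_pos (fun p hp => score_pos P A σ p hp) hP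
  have hnn : ∀ p ∈ (Finset.univ : Finset {x // x ∈ P}), 0 ≤ mu P A σ p := fun p _ =>
    div_nonneg (score_pos P A σ p p.2).le hpos.le
  rw [← ENNReal.ofReal_sum_of_nonneg hnn]
  rw [Finset.sum_coe_sort P (fun p => mu P A σ p)]
  unfold mu
  rw [← Finset.sum_div, div_self hpos.ne', ENNReal.ofReal_one]

/-- The distribution `μ` on `P`. -/
def samplingPMF {d k : ℕ} (P : Finset (Pt d)) (hP : P.Nonempty) (A : Fin k → Pt d)
    (σ : Pt d → Fin k) : PMF {x // x ∈ P} :=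
  PMF.ofFintype (fun p => ENNReal.ofReal (mu P A σ p)) (sum_ofReal_mu P hP A σ)

/-- The law of the `m` independent samples `q_1, …, q_m` from `μ`. -/
def sampleLaw {d k : ℕ} (P : Finset (Pt d)) (hP : P.Nonempty) (A : Fin k → Pt d)
    (σ : Pt d → Fin k) (m : ℕ) : Measure (Fin m → {x // x ∈ P}) :=
  Measure.pi fun _ => (samplingPMF P hP A σ).toMeasure

/-- The weight `1 / (m μ(p))` that a sampled point `p` receives. -/
def sampleWeight {d k : ℕ} (P : Finset (Pt d)) (A : Fin k → Pt d) (σ : Pt d → Fin k) (m : ℕ)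
    (p : Pt d) : ℝ :=
  1 / ((m : ℝ) * mu P A σ p)

/-- The points `q_1, …, q_m` (repetitions allowed) with weights `w_1, …, w_m` form an `ε`-coreset of
`P` for `k`-median: for all `k`-tuples of centers the weighted cost is within `(1 ± ε) cost(P, S)`. -/
def IsCoreset {d m : ℕ} (P : Finset (Pt d)) (k : ℕ) (ε : ℝ) (q : Fin m → Pt d) (w : Fin m → ℝ) :
    Prop :=
  ∀ S : Fin k → Pt d,
    (1 - ε) * cost P S ≤ ∑ i, w i * ptCost (q i) S ∧
      ∑ i, w i * ptCost (q i) S ≤ (1 + ε) * cost P S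

end

end KMedian

/-!
Write `cost(p, S) = [cost(p, S) - cost(a, S)] + cost(a, S)`, where `a` is the center of `A` nearest
to `p`. The second term depends on the cluster of `p` only, so it is estimated well as soon as all
cluster sizes are; symmetrization and Massart's lemma, applied to the self-bounded cluster
indicators, give this with `k * log k / ε ^ 2` samples. The first term is bounded by
`cost(p, A)`, which the sampling density dominates, and its supremum over `S` is bounded by
symmetrization and chaining over nets. The nets do not depend on the dimension, since a direction is
encoded by a sparse signed sum of sample points (Maurey's argument), and their logarithmic size at
scale `δ` is of order `k * (1 + x) / δ ^ 2` up to logarithms, where `x` counts the clusters that are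
ambiguous for `S`, that is, not clearly served by a single center of `S`. Two ambiguous clusters can
be served by fewer centers, so stability forces `cost(P, S)` to be at least of order
`x * β * OPT`: many ambiguous clusters need larger nets, but also allow a larger error. A union
bound over the dyadic ranges of `x` concludes.
-/

namespace KMedian

open scoped BigOperators

theorem one_le_ncard_range {ι β : Type*} [Finite ι] [Nonempty ι] (u : ι → β) :
    (1 : ℝ) ≤ (Set.range u).ncard := by
  exact_mod_cast (Set.ncard_pos (Set.finite_range u)).mpr (Set.range_nonempty u)

theorem log_two_mul_ncard_range_sub_le {ι β : Type*} [Finite ι] [Nonempty ι] [Sub β] (u w : ι → β) :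
    Real.log (2 * (Set.range (u - w)).ncard) ≤
      Real.log 2 + Real.log (Set.range u).ncard + Real.log (Set.range w).ncard := by
  have hsub : Set.range (u - w) ⊆
      (fun z : β × β => z.1 - z.2) '' (Set.range u ×ˢ Set.range w) := by
    rintro _ ⟨t, rfl⟩
    exact ⟨(u t, w t), ⟨⟨t, rfl⟩, ⟨t, rfl⟩⟩, rfl⟩
  have hcard : ((Set.range (u - w)).ncard : ℝ) ≤ (Set.range u).ncard * (Set.range w).ncard := by
    rw [← Nat.cast_mul, ← Set.ncard_prod]
    exact_mod_cast (Set.ncard_le_ncard hsub (Set.toFinite _)).trans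
      (Set.ncard_image_le (Set.toFinite _))
  have hu := one_le_ncard_range u
  have hw := one_le_ncard_range w
  have huw := one_le_ncard_range (u - w)
  rw [← Real.log_mul (by norm_num) (by positivity), ← Real.log_mul (by positivity) (by positivity),
    mul_assoc]
  gcongr

section Rademacher

variable {κ ι : Type*} [Fintype κ] [DecidableEq κ]

/-- The Rademacher average of a family of vectors, without the usual factor `1 / card κ`: the mean
over uniform signs `e` of the largest `|⟨e, v t⟩|`. -/
noncomputable def rademacherAvg (v : ι → κ → ℝ) : ℝ :=
  𝔼 e : κ → ℤˣ, ⨆ t, |∑ i, (e i : ℝ) * v t i|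

theorem abs_intUnit_cast (u : ℤˣ) : |(u : ℝ)| = 1 := by
  rcases Int.units_eq_one_or u with rfl | rfl <;> simp

theorem rademacherAvg_range (v : ι → κ → ℝ) :
    rademacherAvg (Subtype.val : Set.range v → κ → ℝ) = rademacherAvg v :=
  Finset.expect_congr rfl fun e _ => iSup_range' (fun x : κ → ℝ => |∑ i, (e i : ℝ) * x i|) v

theorem rademacherAvg_zero : rademacherAvg (0 : ι → κ → ℝ) = 0 := by
  simp [rademacherAvg]

theorem rademacherAvg_add_le [Finite ι] [Nonempty ι] (u v : ι → κ → ℝ) :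
    rademacherAvg (u + v) ≤ rademacherAvg u + rademacherAvg v := by
  rw [rademacherAvg, rademacherAvg, rademacherAvg, ← Finset.expect_add_distrib]
  refine Finset.expect_le_expect fun e _ => ciSup_le fun t => ?_
  simp only [Pi.add_apply, mul_add, Finset.sum_add_distrib]
  exact (abs_add_le _ _).trans (add_le_add
    (Finite.le_ciSup (fun s => |∑ i, (e i : ℝ) * u s i|) t)
    (Finite.le_ciSup (fun s => |∑ i, (e i : ℝ) * v s i|) t))

theorem rademacherAvg_le_of_abs_le [Nonempty ι] {v : ι → κ → ℝ} {δ : ℝ}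
    (hv : ∀ t i, |v t i| ≤ δ) : rademacherAvg v ≤ Fintype.card κ * δ := by
  refine Finset.expect_le Finset.univ_nonempty fun e _ => ciSup_le fun t => ?_
  calc |∑ i, (e i : ℝ) * v t i| ≤ ∑ i, |(e i : ℝ) * v t i| := Finset.abs_sum_le_sum_abs _ _
    _ ≤ ∑ _i : κ, δ := Finset.sum_le_sum fun i _ => by
        rw [abs_mul, abs_intUnit_cast, one_mul]
        exact hv t i
    _ = Fintype.card κ * δ := by simp

theorem expect_exp_sum_sign_mul_le (v : κ → ℝ) :
    𝔼 e : κ → ℤˣ, Real.exp (∑ i, (e i : ℝ) * v i) ≤ Real.exp ((∑ i, v i ^ 2) / 2) := by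
  calc 𝔼 e : κ → ℤˣ, Real.exp (∑ i, (e i : ℝ) * v i)
      = ∏ i, Real.cosh (v i) := by
        simp only [Fintype.expect_eq_sum_div_card, Real.exp_sum, Real.cosh_eq,
          Finset.prod_div_distrib]
        rw [← Fintype.prod_sum fun i (u : ℤˣ) => Real.exp ((u : ℝ) * v i)]
        simp [Fintype.card_pi, UnitsInt.univ]
    _ ≤ ∏ i, Real.exp (v i ^ 2 / 2) :=
        Finset.prod_le_prod (fun i _ => (Real.cosh_pos _).le) fun i _ =>
          Real.cosh_le_exp_half_sq (v i)
    _ = Real.exp ((∑ i, v i ^ 2) / 2) := by rw [← Real.exp_sum, Finset.sum_div]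

theorem exp_expect_le [Fintype ι] [Nonempty ι] (F : ι → ℝ) :
    Real.exp (𝔼 t, F t) ≤ 𝔼 t, Real.exp (F t) := by
  have hcard : (Fintype.card ι : ℝ) ≠ 0 := by simp
  have h := convexOn_exp.map_sum_le (t := Finset.univ) (p := F)
    (w := fun _ => (Fintype.card ι : ℝ)⁻¹) (fun _ _ => by positivity) (by simp [hcard])
    fun _ _ => Set.mem_univ _
  simpa only [Fintype.expect_eq_sum_div_card, div_eq_inv_mul, Finset.mul_sum, smul_eq_mul] using h

theorem exp_mul_rademacherAvg_le [Fintype ι] [Nonempty ι] {v : ι → κ → ℝ} {s : ℝ}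
    (hs : ∀ t, ∑ i, v t i ^ 2 ≤ s) (l : ℝ) :
    Real.exp (l * rademacherAvg v) ≤ 2 * Fintype.card ι * Real.exp (l ^ 2 * s / 2) := by
  have hsign (c : ℝ) (hc : c ^ 2 = l ^ 2) (t : ι) :
      𝔼 e : κ → ℤˣ, Real.exp (c * ∑ i, (e i : ℝ) * v t i) ≤ Real.exp (l ^ 2 * s / 2) := by
    calc 𝔼 e : κ → ℤˣ, Real.exp (c * ∑ i, (e i : ℝ) * v t i)
        = 𝔼 e : κ → ℤˣ, Real.exp (∑ i, (e i : ℝ) * (c * v t i)) := by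
          simp only [Finset.mul_sum, mul_left_comm]
      _ ≤ Real.exp ((∑ i, (c * v t i) ^ 2) / 2) := expect_exp_sum_sign_mul_le _
      _ ≤ Real.exp (l ^ 2 * s / 2) := by
          simp only [mul_pow, ← Finset.mul_sum, hc]
          gcongr
          exact hs t
  have hsup (e : κ → ℤˣ) : Real.exp (l * ⨆ t, |∑ i, (e i : ℝ) * v t i|) ≤
      ∑ t, (Real.exp (l * ∑ i, (e i : ℝ) * v t i) +
        Real.exp (-l * ∑ i, (e i : ℝ) * v t i)) := by
    obtain ⟨t, ht⟩ := exists_eq_ciSup_of_finite (f := fun t => |∑ i, (e i : ℝ) * v t i|)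
    rw [← ht]
    refine le_trans ?_ (Finset.single_le_sum (fun t _ => by positivity) (Finset.mem_univ t))
    rcases abs_choice (∑ i, (e i : ℝ) * v t i) with h | h
    · rw [h]
      exact le_add_of_nonneg_right (Real.exp_nonneg _)
    · rw [h, mul_neg, ← neg_mul]
      exact le_add_of_nonneg_left (Real.exp_nonneg _)
  calc Real.exp (l * rademacherAvg v)
      ≤ 𝔼 e : κ → ℤˣ, Real.exp (l * ⨆ t, |∑ i, (e i : ℝ) * v t i|) := by
        rw [rademacherAvg, Finset.mul_expect]
        exact exp_expect_le _
    _ ≤ ∑ t, (𝔼 e : κ → ℤˣ, Real.exp (l * ∑ i, (e i : ℝ) * v t i) +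
          𝔼 e : κ → ℤˣ, Real.exp (-l * ∑ i, (e i : ℝ) * v t i)) := by
        simp only [← Finset.expect_add_distrib, ← Finset.expect_sum_comm]
        exact Finset.expect_le_expect fun e _ => hsup e
    _ ≤ ∑ _t : ι, (Real.exp (l ^ 2 * s / 2) + Real.exp (l ^ 2 * s / 2)) :=
        Finset.sum_le_sum fun t _ => add_le_add (hsign l rfl t) (hsign (-l) (neg_sq l) t)
    _ = 2 * Fintype.card ι * Real.exp (l ^ 2 * s / 2) := by
        rw [Finset.sum_const, Finset.card_univ, nsmul_eq_mul]
        ring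

theorem rademacherAvg_le_log_div_add [Finite ι] [Nonempty ι] {v : ι → κ → ℝ} {s l : ℝ}
    (hs : ∀ t, ∑ i, v t i ^ 2 ≤ s) (hl : 0 < l) :
    rademacherAvg v ≤ Real.log (2 * (Set.range v).ncard) / l + l * s / 2 := by
  have : Fintype (Set.range v) := Fintype.ofFinite _
  have : Nonempty (Set.range v) := Set.instNonemptyRange v
  have hcard : (Fintype.card (Set.range v) : ℝ) = (Set.range v).ncard := by
    rw [← Nat.card_eq_fintype_card, Nat.card_coe_set_eq]
  have hexp := exp_mul_rademacherAvg_le (v := (Subtype.val : Set.range v → κ → ℝ)) (s := s)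
    (by rintro ⟨_, t, rfl⟩; exact hs t) l
  rw [rademacherAvg_range, hcard] at hexp
  have hpos : (0 : ℝ) < (Set.range v).ncard := by
    rw [← hcard]
    exact_mod_cast Fintype.card_pos
  have hlog : l * rademacherAvg v ≤ Real.log (2 * (Set.range v).ncard) + l ^ 2 * s / 2 := by
    rw [← Real.exp_le_exp, Real.exp_add, Real.exp_log (by positivity)]
    exact hexp
  calc rademacherAvg v ≤ (Real.log (2 * (Set.range v).ncard) + l ^ 2 * s / 2) / l := by
        rwa [le_div_iff₀ hl, mul_comm]
    _ = _ := by field_simp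

theorem rademacherAvg_le_sqrt [Finite ι] [Nonempty ι] {v : ι → κ → ℝ} {s L : ℝ}
    (hs : ∀ t, ∑ i, v t i ^ 2 ≤ s) (hs0 : 0 < s) (hL : 0 < L)
    (hv : Real.log (2 * (Set.range v).ncard) ≤ L) : rademacherAvg v ≤ √(2 * L * s) := by
  have hroot : √(2 * L / s) ^ 2 = 2 * L / s := Real.sq_sqrt (by positivity)
  have hpos : 0 < √(2 * L / s) := by positivity
  calc rademacherAvg v ≤ Real.log (2 * (Set.range v).ncard) / √(2 * L / s) + √(2 * L / s) * s / 2 :=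
        rademacherAvg_le_log_div_add hs hpos
    _ ≤ L / √(2 * L / s) + √(2 * L / s) * s / 2 := by gcongr
    _ = √(2 * L / s) * s := by
        have : L = √(2 * L / s) ^ 2 * s / 2 := by rw [hroot]; field_simp
        nth_rewrite 1 [this]
        field_simp
        ring
    _ = √(2 * L * s) := by
        rw [show 2 * L * s = 2 * L / s * s ^ 2 by field_simp, Real.sqrt_mul (by positivity),
          Real.sqrt_sq hs0.le]

theorem rademacherAvg_sub_le_of_close [Nonempty κ] [Finite ι] [Nonempty ι]
    {v u w : ι → κ → ℝ} {b Λ : ℝ} (hb : 0 < b) (hΛ : 1 ≤ Λ) {h : ℕ}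
    (hu : Real.log (Set.range u).ncard ≤ 4 ^ (h + 1) * Λ)
    (hw : Real.log (Set.range w).ncard ≤ 4 ^ h * Λ)
    (hvu : ∀ t i, |v t i - u t i| ≤ b / 2 ^ (h + 1)) (hvw : ∀ t i, |v t i - w t i| ≤ b / 2 ^ h) :
    rademacherAvg (u - w) ≤ 8 * b * √(Fintype.card κ * Λ) := by
  have hcard : (0 : ℝ) < Fintype.card κ := by exact_mod_cast Fintype.card_pos
  have h4 : (1 : ℝ) ≤ 4 ^ h := one_le_pow₀ (by norm_num)
  have hlog : Real.log (2 * (Set.range (u - w)).ncard) ≤ 6 * 4 ^ h * Λ := by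
    have := log_two_mul_ncard_range_sub_le u w
    have := Real.log_two_lt_d9
    rw [pow_succ] at hu
    nlinarith
  have hdiff (t : ι) (i : κ) : |(u - w) t i| ≤ 3 * b / (2 * 2 ^ h) := by
    calc |u t i - w t i| ≤ |u t i - v t i| + |v t i - w t i| := abs_sub_le _ _ _
      _ ≤ b / 2 ^ (h + 1) + b / 2 ^ h := add_le_add (abs_sub_comm (u t i) _ ▸ hvu t i) (hvw t i)
      _ = 3 * b / (2 * 2 ^ h) := by field_simp; ring
  have hsq (t : ι) : ∑ i, (u - w) t i ^ 2 ≤ Fintype.card κ * (3 * b / (2 * 2 ^ h)) ^ 2 := by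
    simpa using Finset.sum_le_sum fun i (_ : i ∈ Finset.univ) =>
      (sq_abs ((u - w) t i)).symm.trans_le (pow_le_pow_left₀ (abs_nonneg _) (hdiff t i) 2)
  calc rademacherAvg (u - w)
      ≤ √(2 * (6 * 4 ^ h * Λ) * (Fintype.card κ * (3 * b / (2 * 2 ^ h)) ^ 2)) :=
        rademacherAvg_le_sqrt hsq (by positivity) (by positivity) hlog
    _ = √(27 * (b ^ 2 * (Fintype.card κ * Λ))) := by
        have : (4 : ℝ) ^ h = (2 ^ h) ^ 2 := by rw [← pow_mul, mul_comm, pow_mul]; norm_num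
        rw [this]
        field_simp
        ring_nf
    _ ≤ √((8 * b) ^ 2 * (Fintype.card κ * Λ)) := by
        refine Real.sqrt_le_sqrt ?_
        have : 0 ≤ b ^ 2 * (Fintype.card κ * Λ) := by positivity
        linarith
    _ = 8 * b * √(Fintype.card κ * Λ) := by
        rw [Real.sqrt_mul (sq_nonneg (8 * b)), Real.sqrt_sq (by positivity)]

theorem rademacherAvg_le_sum_rademacherAvg_sub [Finite ι] [Nonempty ι] {G : ℕ → ι → κ → ℝ}
    (hG : G 0 = 0) (H : ℕ) :
    rademacherAvg (G H) ≤ ∑ h ∈ Finset.range H, rademacherAvg (G (h + 1) - G h) := by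
  induction H with
  | zero => simp [hG, rademacherAvg_zero]
  | succ H ih =>
    rw [Finset.sum_range_succ, ← sub_add_cancel (G (H + 1)) (G H), add_comm (_ - _)]
    refine (rademacherAvg_add_le _ _).trans ?_
    rw [add_sub_cancel]
    gcongr

/-- Chaining: the number of values allowed at scale `b / 2 ^ h` is chosen such that every scale
contributes the same amount. -/
theorem rademacherAvg_le_of_approximations [Nonempty κ] [Finite ι] [Nonempty ι]
    {v : ι → κ → ℝ} {b Λ : ℝ} (hb : 0 < b) (hΛ : 1 ≤ Λ) (hv : ∀ t i, |v t i| ≤ b) (H : ℕ)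
    (happrox : ∀ h ≤ H, ∃ u : ι → κ → ℝ, Real.log (Set.range u).ncard ≤ 4 ^ h * Λ ∧
      ∀ t i, |v t i - u t i| ≤ b / 2 ^ h) :
    rademacherAvg v ≤
      8 * H * b * √(Fintype.card κ * Λ) + b * Fintype.card κ / 2 ^ H := by
  choose! u hucard hu using happrox
  let G : ℕ → ι → κ → ℝ := fun h => if h = 0 then 0 else u h
  have hGcard (h : ℕ) (hh : h ≤ H) : Real.log (Set.range (G h)).ncard ≤ 4 ^ h * Λ := by
    rcases eq_or_ne h 0 with rfl | h0
    · have : Set.range (G 0) = {0} := Set.range_const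
      rw [this, Set.ncard_singleton, Nat.cast_one, Real.log_one]
      positivity
    · simpa only [G, if_neg h0] using hucard h hh
  have hG (h : ℕ) (hh : h ≤ H) (t : ι) (i : κ) : |v t i - G h t i| ≤ b / 2 ^ h := by
    rcases eq_or_ne h 0 with rfl | h0
    · simpa [G] using hv t i
    · simpa only [G, if_neg h0] using hu h hh t i
  calc rademacherAvg v = rademacherAvg (G H + (v - G H)) := by rw [add_sub_cancel]
    _ ≤ rademacherAvg (G H) + rademacherAvg (v - G H) := rademacherAvg_add_le _ _
    _ ≤ ∑ h ∈ Finset.range H, rademacherAvg (G (h + 1) - G h) +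
          Fintype.card κ * (b / 2 ^ H) :=
        add_le_add (rademacherAvg_le_sum_rademacherAvg_sub rfl H)
          (rademacherAvg_le_of_abs_le (hG H le_rfl))
    _ ≤ ∑ _h ∈ Finset.range H, 8 * b * √(Fintype.card κ * Λ) + Fintype.card κ * (b / 2 ^ H) := by
        gcongr with h hh
        have hhH : h < H := Finset.mem_range.mp hh
        exact rademacherAvg_sub_le_of_close hb hΛ (hGcard _ hhH) (hGcard _ hhH.le) (hG _ hhH)
          (hG _ hhH.le)
    _ = 8 * H * b * √(Fintype.card κ * Λ) + b * Fintype.card κ / 2 ^ H := by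
        rw [Finset.sum_const, Finset.card_range, nsmul_eq_mul]
        ring

end Rademacher

section Symmetrization

variable {α κ ι : Type*} [MeasurableSpace α]

theorem integrable_ciSup_abs {μ : Measure α} [Finite ι] {g : ι → α → ℝ}
    (hg : ∀ t, Integrable (g t) μ) : Integrable (fun x => ⨆ t, |g t x|) μ := by
  have := Fintype.ofFinite ι
  refine (integrable_finsetSum Finset.univ fun t _ => (hg t).abs).mono'
    (AEMeasurable.iSup fun t => (hg t).abs.aemeasurable).aestronglyMeasurable
    (Filter.Eventually.of_forall fun x => ?_)
  rw [Real.norm_of_nonneg (Real.iSup_nonneg fun t => abs_nonneg _)]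
  exact Real.iSup_le (fun t => Finset.single_le_sum (f := fun t => |g t x|)
    (fun _ _ => abs_nonneg _) (Finset.mem_univ t)) (Finset.sum_nonneg fun _ _ => abs_nonneg _)

variable [Fintype κ] {μ : Measure α}

theorem integral_comp_pi_eq {β : Type*} [MeasurableSpace β] {ν : Measure β} [SigmaFinite ν]
    {f : κ → α → β} (hf : ∀ i, MeasurePreserving (f i) μ ν) {F : (κ → β) → ℝ}
    (hF : AEStronglyMeasurable F (Measure.pi fun _ => ν)) :
    ∫ z, F (fun i => f i (z i)) ∂(Measure.pi fun _ => μ) = ∫ y, F y ∂(Measure.pi fun _ => ν) := by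
  have h := measurePreserving_pi (fun _ : κ => μ) (fun _ => ν) hf
  rw [← h.map_eq, integral_map h.aemeasurable (h.map_eq ▸ hF)]

variable [IsProbabilityMeasure μ] {f : ι → α → ℝ}

theorem integral_sum_comp_eval {g : α → ℝ} (hg : Integrable g μ) :
    ∫ q, ∑ i, g (q i) ∂(Measure.pi fun _ : κ => μ) = Fintype.card κ * ∫ x, g x ∂μ := by
  rw [integral_finsetSum _ fun i _ => integrable_comp_eval (μ := fun _ : κ => μ) hg]
  simp [integral_comp_eval (μ := fun _ : κ => μ) hg.aestronglyMeasurable]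

theorem integrable_ciSup_abs_sum_mul [Finite ι] (hf : ∀ t, Integrable (f t) μ) (e : κ → ℝ) :
    Integrable (fun q : κ → α => ⨆ t, |∑ i, e i * f t (q i)|) (Measure.pi fun _ => μ) :=
  integrable_ciSup_abs fun t => integrable_finsetSum _ fun i _ =>
    (integrable_comp_eval (μ := fun _ : κ => μ) (i := i) (hf t)).const_mul (e i)

theorem integrable_ciSup_abs_sum_sub [Finite ι] (hf : ∀ t, Integrable (f t) μ) :
    Integrable (fun z : κ → α × α => ⨆ t, |∑ i, (f t (z i).1 - f t (z i).2)|)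
      (Measure.pi fun _ => μ.prod μ) :=
  integrable_ciSup_abs fun t => integrable_finsetSum _ fun i _ =>
    integrable_comp_eval (μ := fun _ : κ => μ.prod μ) (i := i)
      (f := fun z => f t z.1 - f t z.2) (((hf t).comp_fst μ).sub ((hf t).comp_snd μ))

/-- The ghost sample: `b` is an independent copy of `a`, and `card κ * ∫ f` is the mean of
`∑ f (b i)`. -/
theorem integral_ciSup_abs_sum_sub_mean_le [Finite ι] [Nonempty ι]
    (hf : ∀ t, Integrable (f t) μ) :
    ∫ q, ⨆ t, |∑ i, f t (q i) - Fintype.card κ * ∫ x, f t x ∂μ| ∂(Measure.pi fun _ : κ => μ) ≤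
      ∫ z : κ → α × α, ⨆ t, |∑ i, (f t (z i).1 - f t (z i).2)|
        ∂(Measure.pi fun _ => μ.prod μ) := by
  have hint (t : ι) : Integrable (fun b : κ → α => ∑ i, f t (b i)) (Measure.pi fun _ => μ) :=
    integrable_finsetSum _ fun i _ => integrable_comp_eval (μ := fun _ : κ => μ) (hf t)
  have hpair := integrable_ciSup_abs_sum_sub (κ := κ) hf
  have he := measurePreserving_arrowProdEquivProdArrow α α κ (fun _ => μ) (fun _ => μ)
  have hprod : Integrable (fun p : (κ → α) × (κ → α) => ⨆ t, |∑ i, (f t (p.1 i) - f t (p.2 i))|)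
      ((Measure.pi fun _ => μ).prod (Measure.pi fun _ => μ)) := by
    rw [← he.integrable_comp_emb (MeasurableEquiv.measurableEmbedding _)]
    exact hpair
  have hghost (a : κ → α) (t : ι) :
      |∑ i, f t (a i) - Fintype.card κ * ∫ x, f t x ∂μ| ≤
        ∫ b : κ → α, ⨆ t, |∑ i, (f t (a i) - f t (b i))| ∂(Measure.pi fun _ => μ) := by
    have hsub (t : ι) : Integrable (fun b : κ → α => ∑ i, (f t (a i) - f t (b i)))
        (Measure.pi fun _ => μ) := by
      simp only [Finset.sum_sub_distrib]
      exact (integrable_const _).sub (hint t)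
    calc |∑ i, f t (a i) - Fintype.card κ * ∫ x, f t x ∂μ|
        = |∫ b : κ → α, ∑ i, (f t (a i) - f t (b i)) ∂(Measure.pi fun _ => μ)| := by
          simp only [Finset.sum_sub_distrib]
          rw [integral_sub (integrable_const _) (hint t), integral_sum_comp_eval (hf t)]
          simp
      _ ≤ ∫ b : κ → α, |∑ i, (f t (a i) - f t (b i))| ∂(Measure.pi fun _ => μ) :=
          abs_integral_le_integral_abs
      _ ≤ _ := integral_mono (hsub t).abs (integrable_ciSup_abs hsub) fun b =>
          Finite.le_ciSup (fun t => |∑ i, (f t (a i) - f t (b i))|) t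
  calc ∫ q, ⨆ t, |∑ i, f t (q i) - Fintype.card κ * ∫ x, f t x ∂μ| ∂(Measure.pi fun _ : κ => μ)
      ≤ ∫ a : κ → α, ∫ b : κ → α, ⨆ t, |∑ i, (f t (a i) - f t (b i))|
          ∂(Measure.pi fun _ => μ) ∂(Measure.pi fun _ => μ) :=
        integral_mono (integrable_ciSup_abs fun t => (hint t).sub (integrable_const _))
          hprod.integral_prod_left fun a => ciSup_le (hghost a)
    _ = ∫ p : (κ → α) × (κ → α), ⨆ t, |∑ i, (f t (p.1 i) - f t (p.2 i))|
          ∂((Measure.pi fun _ => μ).prod (Measure.pi fun _ => μ)) := (integral_prod _ hprod).symm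
    _ = _ := (he.integral_comp' (g := fun p : (κ → α) × (κ → α) =>
          ⨆ t, |∑ i, (f t (p.1 i) - f t (p.2 i))|)).symm

/-- Swapping `(z i).1` and `(z i).2` preserves the law and changes the sign of the `i`-th term. -/
theorem integral_ciSup_abs_sum_sub_eq [Finite ι] (hf : ∀ t, Integrable (f t) μ) (e : κ → ℤˣ) :
    ∫ z : κ → α × α, ⨆ t, |∑ i, (f t (z i).1 - f t (z i).2)| ∂(Measure.pi fun _ => μ.prod μ) =
      ∫ z : κ → α × α, ⨆ t, |∑ i, (e i : ℝ) * (f t (z i).1 - f t (z i).2)|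
        ∂(Measure.pi fun _ => μ.prod μ) := by
  let swap (i : κ) : α × α → α × α := if e i = 1 then id else Prod.swap
  have hswap (i : κ) : MeasurePreserving (swap i) (μ.prod μ) (μ.prod μ) := by
    by_cases h : e i = 1
    · simpa only [swap, if_pos h] using MeasurePreserving.id _
    · simpa only [swap, if_neg h] using Measure.measurePreserving_swap
  have hsign (t : ι) (i : κ) (z : α × α) :
      f t (swap i z).1 - f t (swap i z).2 = (e i : ℝ) * (f t z.1 - f t z.2) := by
    rcases Int.units_eq_one_or (e i) with h | h <;> simp [swap, h]
  rw [← integral_comp_pi_eq hswap (integrable_ciSup_abs_sum_sub hf).aestronglyMeasurable]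
  simp only [hsign]

theorem integral_ciSup_abs_sum_mul_sub_le [Finite ι] [Nonempty ι] (hf : ∀ t, Integrable (f t) μ)
    (e : κ → ℝ) :
    ∫ z : κ → α × α, ⨆ t, |∑ i, e i * (f t (z i).1 - f t (z i).2)|
        ∂(Measure.pi fun _ => μ.prod μ) ≤
      2 * ∫ q : κ → α, ⨆ t, |∑ i, e i * f t (q i)| ∂(Measure.pi fun _ => μ) := by
  let F (q : κ → α) : ℝ := ⨆ t, |∑ i, e i * f t (q i)|
  have hF : Integrable F (Measure.pi fun _ => μ) := integrable_ciSup_abs_sum_mul hf e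
  have hfst := measurePreserving_pi (fun _ : κ => μ.prod μ) _
    fun _ => measurePreserving_fst (μ := μ) (ν := μ)
  have hsnd := measurePreserving_pi (fun _ : κ => μ.prod μ) _
    fun _ => measurePreserving_snd (μ := μ) (ν := μ)
  have hF₁ : Integrable (fun z : κ → α × α => F fun i => (z i).1) (Measure.pi fun _ => μ.prod μ) :=
    hfst.integrable_comp_of_integrable hF
  have hF₂ : Integrable (fun z : κ → α × α => F fun i => (z i).2) (Measure.pi fun _ => μ.prod μ) :=
    hsnd.integrable_comp_of_integrable hF
  have hle (z : κ → α × α) : ⨆ t, |∑ i, e i * (f t (z i).1 - f t (z i).2)| ≤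
      F (fun i => (z i).1) + F fun i => (z i).2 := by
    refine ciSup_le fun t => ?_
    simp only [mul_sub, Finset.sum_sub_distrib]
    exact (abs_sub _ _).trans (add_le_add
      (Finite.le_ciSup (fun t => |∑ i, e i * f t (z i).1|) t)
      (Finite.le_ciSup (fun t => |∑ i, e i * f t (z i).2|) t))
  calc ∫ z : κ → α × α, ⨆ t, |∑ i, e i * (f t (z i).1 - f t (z i).2)|
        ∂(Measure.pi fun _ => μ.prod μ)
      ≤ ∫ z : κ → α × α, (F (fun i => (z i).1) + F fun i => (z i).2)
          ∂(Measure.pi fun _ => μ.prod μ) :=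
        integral_mono_of_nonneg (Filter.Eventually.of_forall fun z =>
          Real.iSup_nonneg fun t => abs_nonneg _) (hF₁.add hF₂) (Filter.Eventually.of_forall hle)
    _ = 2 * ∫ q, F q ∂(Measure.pi fun _ => μ) := by
        rw [integral_add hF₁ hF₂,
          integral_comp_pi_eq (fun _ => measurePreserving_fst) hF.aestronglyMeasurable,
          integral_comp_pi_eq (fun _ => measurePreserving_snd) hF.aestronglyMeasurable, two_mul]

section

variable [DecidableEq κ]

theorem integrable_rademacherAvg [Finite ι] (hf : ∀ t, Integrable (f t) μ) :
    Integrable (fun q : κ → α => rademacherAvg fun t i => f t (q i)) (Measure.pi fun _ => μ) := by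
  simp only [rademacherAvg, Fintype.expect_eq_sum_div_card]
  exact (integrable_finsetSum _ fun e _ => integrable_ciSup_abs_sum_mul hf _).div_const _

theorem integral_ciSup_abs_sum_sub_mean_le_rademacherAvg [Finite ι] [Nonempty ι]
    (hf : ∀ t, Integrable (f t) μ) :
    ∫ q, ⨆ t, |∑ i, f t (q i) - Fintype.card κ * ∫ x, f t x ∂μ| ∂(Measure.pi fun _ : κ => μ) ≤
      2 * ∫ q : κ → α, rademacherAvg (fun t i => f t (q i)) ∂(Measure.pi fun _ => μ) := by
  have hsigned (e : κ → ℤˣ) :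
      ∫ q, ⨆ t, |∑ i, f t (q i) - Fintype.card κ * ∫ x, f t x ∂μ| ∂(Measure.pi fun _ : κ => μ) ≤
        2 * ∫ q : κ → α, ⨆ t, |∑ i, (e i : ℝ) * f t (q i)| ∂(Measure.pi fun _ => μ) := by
    refine (integral_ciSup_abs_sum_sub_mean_le hf).trans ?_
    rw [integral_ciSup_abs_sum_sub_eq hf e]
    exact integral_ciSup_abs_sum_mul_sub_le hf _
  refine (Finset.le_expect Finset.univ_nonempty fun e _ => hsigned e).trans_eq ?_
  simp only [rademacherAvg, Fintype.expect_eq_sum_div_card]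
  rw [integral_div, integral_finsetSum _ fun e _ => integrable_ciSup_abs_sum_mul hf _,
    ← Finset.mul_sum, mul_div_assoc]

theorem rademacherAvg_le_of_mem_Icc [Finite ι] [Nonempty ι] {v : ι → κ → ℝ} {B θ T : ℝ}
    (hB : 0 < B) (hθ : 0 < θ) (hv : ∀ t i, v t i ∈ Set.Icc 0 B) (hsum : ∀ t, ∑ i, v t i ≤ T) :
    rademacherAvg v ≤ 2 * B * Real.log (2 * Nat.card ι) / θ + θ / 4 * T := by
  have hsq (t : ι) : ∑ i, v t i ^ 2 ≤ B * T :=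
    calc ∑ i, v t i ^ 2 ≤ ∑ i, B * v t i := Finset.sum_le_sum fun i _ => by
          rw [sq]
          exact mul_le_mul_of_nonneg_right (hv t i).2 (hv t i).1
      _ ≤ B * T := by
          rw [← Finset.mul_sum]
          exact mul_le_mul_of_nonneg_left (hsum t) hB.le
  have hcard : ((Set.range v).ncard : ℝ) ≤ Nat.card ι := by
    rw [← Set.image_univ, ← Set.ncard_univ]
    exact_mod_cast Set.ncard_image_le (Set.toFinite _)
  have hrange := one_le_ncard_range v
  calc rademacherAvg v
      ≤ Real.log (2 * (Set.range v).ncard) / (θ / (2 * B)) + θ / (2 * B) * (B * T) / 2 :=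
        rademacherAvg_le_log_div_add hsq (by positivity)
    _ ≤ Real.log (2 * Nat.card ι) / (θ / (2 * B)) + θ / (2 * B) * (B * T) / 2 := by gcongr
    _ = 2 * B * Real.log (2 * Nat.card ι) / θ + θ / 4 * T := by
        field_simp
        ring

end

/-- The variance of `∑ f (q i)` is controlled by its values, so that the largest deviation bounds
itself. -/
theorem integral_ciSup_abs_sum_sub_mean_le_of_mem_Icc [Finite ι] [Nonempty ι] {B θ : ℝ}
    (hB : 0 < B) (hθ : 0 < θ) (hθ1 : θ ≤ 1) (hf : ∀ t, Integrable (f t) μ)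
    (hfB : ∀ t x, f t x ∈ Set.Icc 0 B) (hmean : ∀ t, ∫ x, f t x ∂μ ≤ 1)
    (hκ : 8 * B * Real.log (2 * Nat.card ι) ≤ θ ^ 2 * Fintype.card κ) :
    ∫ q, ⨆ t, |∑ i, f t (q i) - Fintype.card κ * ∫ x, f t x ∂μ| ∂(Measure.pi fun _ : κ => μ) ≤
      2 * θ * Fintype.card κ := by
  classical
  let X (q : κ → α) : ℝ := ⨆ t, |∑ i, f t (q i) - Fintype.card κ * ∫ x, f t x ∂μ|
  have hX : Integrable X (Measure.pi fun _ => μ) := integrable_ciSup_abs fun t =>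
    (integrable_finsetSum _ fun i _ => integrable_comp_eval (μ := fun _ : κ => μ) (hf t)).sub
      (integrable_const _)
  have hsum (q : κ → α) (t : ι) : ∑ i, f t (q i) ≤ Fintype.card κ + X q := by
    have hdev := Finite.le_ciSup (fun t => |∑ i, f t (q i) - Fintype.card κ * ∫ x, f t x ∂μ|) t
    have hm := mul_le_mul_of_nonneg_left (hmean t) (Nat.cast_nonneg' (α := ℝ) (Fintype.card κ))
    linarith [(le_abs_self _).trans hdev]
  have hlog : 2 * B * Real.log (2 * Nat.card ι) / θ ≤ θ / 4 * Fintype.card κ := by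
    rw [div_le_iff₀ hθ]
    linarith
  have hrad (q : κ → α) : rademacherAvg (fun t i => f t (q i)) ≤
      θ / 2 * Fintype.card κ + θ / 4 * X q := by
    have := rademacherAvg_le_of_mem_Icc hB hθ (fun t i => hfB t (q i)) (hsum q)
    linarith
  have hself : ∫ q, X q ∂(Measure.pi fun _ => μ) ≤
      2 * (θ / 2 * Fintype.card κ + θ / 4 * ∫ q, X q ∂(Measure.pi fun _ => μ)) := by
    refine (integral_ciSup_abs_sum_sub_mean_le_rademacherAvg hf).trans ?_
    have := integral_mono (integrable_rademacherAvg hf)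
      ((integrable_const _).add (hX.const_mul _)) hrad
    rw [integral_add' (integrable_const _) (hX.const_mul _), integral_const, probReal_univ,
      one_smul, integral_const_mul] at this
    exact mul_le_mul_of_nonneg_left this zero_le_two
  have hnonneg : 0 ≤ ∫ q, X q ∂(Measure.pi fun _ => μ) :=
    integral_nonneg fun q => Real.iSup_nonneg fun t => abs_nonneg _
  nlinarith

end Symmetrization

section Geometry

variable {d k : ℕ}

theorem ptCost_le_dist (p : Pt d) (S : Fin k → Pt d) (i : Fin k) : ptCost p S ≤ dist p (S i) :=
  ciInf_le (Set.finite_range _).bddBelow i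

theorem exists_dist_eq_ptCost [NeZero k] (p : Pt d) (S : Fin k → Pt d) :
    ∃ i, dist p (S i) = ptCost p S :=
  exists_eq_ciInf_of_finite

theorem ptCost_le_dist_add_ptCost [NeZero k] (p q : Pt d) (S : Fin k → Pt d) :
    ptCost p S ≤ dist p q + ptCost q S := by
  obtain ⟨i, hi⟩ := exists_dist_eq_ptCost q S
  rw [← hi]
  exact (ptCost_le_dist p S i).trans (dist_triangle _ _ _)

theorem opt_le_cost (P : Finset (Pt d)) (S : Fin k → Pt d) : opt P k ≤ cost P S :=
  ciInf_le ⟨0, by rintro _ ⟨S, rfl⟩; exact cost_nonneg P S⟩ S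

theorem opt_nonneg (P : Finset (Pt d)) (k : ℕ) : 0 ≤ opt P k :=
  Real.iInf_nonneg fun _ => cost_nonneg _ _

theorem ptCost_eq_of_isNearest {P : Finset (Pt d)} {A : Fin k → Pt d} {σ : Pt d → Fin k}
    (h : IsNearest P A σ) {p : Pt d} (hp : p ∈ P) : ptCost p A = dist p (A (σ p)) := by
  have : Nonempty (Fin k) := ⟨σ p⟩
  exact le_antisymm (ptCost_le_dist _ _ _) (le_ciInf fun i => h p hp i)

/-- A point `p` that was served by the center `i` moves to the nearest center of `s p`, which is not
deleted. -/
theorem opt_le_cost_add_of_delete {n : ℕ} (P : Finset (Pt d)) (B : Fin (n + 1) → Pt d)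
    {π : Pt d → Fin (n + 1)} (hπ : ∀ x, dist x (B (π x)) = ptCost x B) (s : Pt d → Pt d)
    {i : Fin (n + 1)} (hi : ∀ p ∈ P, π (s p) ≠ i) :
    opt P n ≤ cost P B + 2 * ∑ p ∈ P with π p = i, dist p (s p) := by
  refine (opt_le_cost P fun j => B (i.succAbove j)).trans ?_
  rw [cost, cost, Finset.mul_sum, Finset.sum_filter, ← Finset.sum_add_distrib]
  refine Finset.sum_le_sum fun p hp => ?_
  split_ifs with h
  · obtain ⟨j, hj⟩ := Fin.exists_succAbove_eq (hi p hp)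
    calc ptCost p (fun j => B (i.succAbove j)) ≤ dist p (B (π (s p))) :=
          hj ▸ ptCost_le_dist p _ j
      _ ≤ dist p (s p) + dist (s p) (B (π (s p))) := dist_triangle _ _ _
      _ ≤ dist p (s p) + (dist (s p) p + ptCost p B) := by
          rw [hπ]
          have : NeZero (n + 1) := ⟨n.succ_ne_zero⟩
          gcongr
          exact ptCost_le_dist_add_ptCost _ _ _
      _ = ptCost p B + 2 * dist p (s p) := by rw [dist_comm (s p)]; ring
  · obtain ⟨j, hj⟩ := Fin.exists_succAbove_eq h
    rw [add_zero, ← hπ p, ← hj]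
    exact ptCost_le_dist p _ j

/-- At least `n + 1 - T.card` centers of `B` serve no point of `T`. Delete each of them in turn and
add up the inequalities. -/
theorem sub_card_mul_opt_sub_cost_le {n : ℕ} (P T : Finset (Pt d)) (s : Pt d → Pt d)
    (hs : ∀ p ∈ P, s p ∈ T) (hT : T.card ≤ n + 1) (B : Fin (n + 1) → Pt d) :
    ((n + 1 : ℝ) - T.card) * (opt P n - cost P B) ≤ 2 * ∑ p ∈ P, dist p (s p) := by
  choose π hπ using fun x => exists_dist_eq_ptCost x B
  have hsum : 0 ≤ ∑ p ∈ P, dist p (s p) := Finset.sum_nonneg fun _ _ => dist_nonneg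
  let U : Finset (Fin (n + 1)) := (T.image π)ᶜ
  have hU : (n + 1 : ℝ) - T.card ≤ U.card := by
    have hcard := Finset.card_compl_add_card (T.image π)
    rw [Fintype.card_fin] at hcard
    rw [sub_le_iff_le_add]
    exact_mod_cast hcard.symm.trans_le (Nat.add_le_add_left Finset.card_image_le _)
  rcases le_total (opt P n) (cost P B) with h | h
  · have hT' : (T.card : ℝ) ≤ n + 1 := by exact_mod_cast hT
    nlinarith
  calc ((n + 1 : ℝ) - T.card) * (opt P n - cost P B)
      ≤ U.card * (opt P n - cost P B) := mul_le_mul_of_nonneg_right hU (sub_nonneg.mpr h)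
    _ = ∑ _i ∈ U, (opt P n - cost P B) := by rw [Finset.sum_const, nsmul_eq_mul]
    _ ≤ ∑ i ∈ U, 2 * ∑ p ∈ P with π p = i, dist p (s p) := by
        refine Finset.sum_le_sum fun i hi => sub_le_iff_le_add'.mpr ?_
        refine opt_le_cost_add_of_delete P B hπ s fun p hp hpi => ?_
        exact Finset.mem_compl.mp hi (hpi ▸ Finset.mem_image_of_mem π (hs p hp))
    _ ≤ ∑ i, 2 * ∑ p ∈ P with π p = i, dist p (s p) :=
        Finset.sum_le_univ_sum_of_nonneg fun i =>
          mul_nonneg zero_le_two (Finset.sum_nonneg fun _ _ => dist_nonneg)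
    _ = 2 * ∑ p ∈ P, dist p (s p) := by rw [← Finset.mul_sum, Finset.sum_fiberwise]

theorem mul_opt_le_of_isStable {P : Finset (Pt d)} {β : ℝ} (hst : IsStable P k β) (hk : 2 ≤ k)
    {T : Finset (Pt d)} (hT : T.card < k) {s : Pt d → Pt d} (hs : ∀ p ∈ P, s p ∈ T) :
    ((k : ℝ) - T.card) * (β * opt P k) ≤ 2 * ∑ p ∈ P, dist p (s p) := by
  obtain ⟨n, rfl⟩ : ∃ n, k = n + 1 := ⟨k - 1, by omega⟩
  have hpos : (0 : ℝ) < (n + 1 : ℕ) - T.card := sub_pos.mpr (by exact_mod_cast hT)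
  have hopt : opt P n - (2 * ∑ p ∈ P, dist p (s p)) / ((n + 1 : ℕ) - T.card) ≤ opt P (n + 1) := by
    refine le_ciInf fun B => ?_
    rw [sub_le_comm, le_div_iff₀' hpos]
    push_cast
    exact sub_card_mul_opt_sub_cost_le P T s hs hT.le B
  have hst' : opt P (n + 1) * (1 + β) ≤ opt P n := hst hk
  rw [← le_div_iff₀' hpos]
  linarith

theorem expect_ite_disjoint {ι : Type*} [Fintype ι] [DecidableEq ι] (N : Finset ι) :
    𝔼 B : Finset ι, (if Disjoint N B then (1 : ℝ) else 0) = (1 / 2) ^ N.card := by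
  have hfilter : (Finset.univ.filter fun B : Finset ι => Disjoint N B) = Nᶜ.powerset := by
    ext B
    simp [Finset.subset_compl_iff_disjoint_left]
  have hcard := Finset.card_add_card_compl N
  rw [Fintype.expect_eq_sum_div_card, Finset.sum_boole, hfilter, Finset.card_powerset,
    Fintype.card_finset, ← hcard, pow_add]
  push_cast
  field_simp
  rw [← mul_pow]
  norm_num

theorem expect_card {ι : Type*} [Fintype ι] :
    𝔼 B : Finset ι, (B.card : ℝ) = Fintype.card ι / 2 := by
  classical
  have hind (B : Finset ι) : (B.card : ℝ) = ∑ s, (1 - if Disjoint {s} B then (1 : ℝ) else 0) := by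
    calc (B.card : ℝ) = ∑ s, if s ∈ B then 1 else 0 := by simp
      _ = _ := Finset.sum_congr rfl fun s _ => by by_cases h : s ∈ B <;> simp [h]
  simp only [hind, Finset.expect_sum_comm, Finset.expect_sub_distrib, expect_ite_disjoint]
  simp
  ring

/-- A uniformly random set meets each set with at least two elements with probability at least
`3 / 4`; one representative is added for each set that it misses. -/
theorem exists_transversal {ι : Type*} [Fintype ι] (N : ι → Finset ι)
    (hN : ∀ j, (N j).Nonempty) :
    ∃ D : Finset ι, (∀ j, ∃ s ∈ N j, s ∈ D) ∧
      4 * D.card + (Finset.univ.filter fun j => 2 ≤ (N j).card).card ≤ 4 * Fintype.card ι := by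
  classical
  choose f hf using hN
  let missed (B : Finset ι) : Finset ι := Finset.univ.filter fun j => Disjoint (N j) B
  have hprob (j : ι) :
      (1 / 2 : ℝ) ^ (N j).card ≤ 1 / 2 - (if 2 ≤ (N j).card then 1 else 0) / 4 := by
    have hpos : 1 ≤ (N j).card := Finset.card_pos.mpr ⟨f j, hf j⟩
    split_ifs with h
    · refine (pow_le_pow_of_le_one (by norm_num) (by norm_num) h).trans (by norm_num)
    · refine (pow_le_pow_of_le_one (by norm_num) (by norm_num) hpos).trans (by norm_num)
  have hmean : 𝔼 B : Finset ι, ((B.card : ℝ) + (missed B).card) ≤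
      Fintype.card ι - ((Finset.univ.filter fun j => 2 ≤ (N j).card).card : ℝ) / 4 := by
    simp only [missed, Finset.natCast_card_filter]
    rw [Finset.expect_add_distrib, expect_card, Finset.expect_sum_comm]
    simp only [expect_ite_disjoint]
    refine (add_le_add_right (Finset.sum_le_sum fun j _ => hprob j) _).trans_eq ?_
    rw [Finset.sum_sub_distrib, Finset.sum_const, ← Finset.sum_div, Finset.card_univ, nsmul_eq_mul]
    ring
  obtain ⟨B, -, hB⟩ := Finset.exists_le_of_expect_le Finset.univ_nonempty hmean
  refine ⟨B ∪ (missed B).image f, fun j => ?_, ?_⟩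
  · by_cases h : Disjoint (N j) B
    · exact ⟨f j, hf j,
        Finset.mem_union_right _ (Finset.mem_image_of_mem f (by simpa [missed] using h))⟩
    · obtain ⟨s, hsN, hsB⟩ := Finset.not_disjoint_iff.mp h
      exact ⟨s, hsN, Finset.mem_union_left _ hsB⟩
  · have hcard : (B ∪ (missed B).image f).card ≤ B.card + (missed B).card :=
      (Finset.card_union_le _ _).trans (Nat.add_le_add_left Finset.card_image_le _)
    have hcast : ((B ∪ (missed B).image f).card : ℝ) ≤ B.card + (missed B).card := by
      exact_mod_cast hcard
    have : (4 * (B ∪ (missed B).image f).card +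
        (Finset.univ.filter fun j => 2 ≤ (N j).card).card : ℝ) ≤ 4 * Fintype.card ι := by linarith
    exact_mod_cast this

/-- The centers of `S` that are, up to a factor of `3`, nearest to `a`. -/
noncomputable def nearCenters (S : Fin k → Pt d) (a : Pt d) : Finset (Fin k) :=
  Finset.univ.filter fun s => dist a (S s) ≤ 3 * ptCost a S

/-- The clusters of `A` whose center has several near centers in `S`. For the other clusters, the
nearest center in `S` is well determined, and stability of the instance bounds the number of
ambiguous ones by the cost of `S`. -/
noncomputable def ambiguous (A S : Fin k → Pt d) : Finset (Fin k) :=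
  Finset.univ.filter fun j => 2 ≤ (nearCenters S (A j)).card

theorem mem_nearCenters {S : Fin k → Pt d} {a : Pt d} {s : Fin k} :
    s ∈ nearCenters S a ↔ dist a (S s) ≤ 3 * ptCost a S := by
  simp [nearCenters]

theorem nearCenters_nonempty [NeZero k] (S : Fin k → Pt d) (a : Pt d) :
    (nearCenters S a).Nonempty := by
  obtain ⟨i, hi⟩ := exists_dist_eq_ptCost a S
  exact ⟨i, mem_nearCenters.mpr (by linarith [ptCost_nonneg a S])⟩

theorem sum_dist_nearCenter_le {P : Finset (Pt d)} {A : Fin k → Pt d} {σ : Pt d → Fin k}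
    (hσ : IsNearest P A σ) {S : Fin k → Pt d} {g : Fin k → Fin k}
    (hg : ∀ j, g j ∈ nearCenters S (A j)) :
    ∑ p ∈ P, dist p (S (g (σ p))) ≤ 3 * cost P S + 4 * cost P A := by
  rw [cost, cost, Finset.mul_sum, Finset.mul_sum, ← Finset.sum_add_distrib]
  refine Finset.sum_le_sum fun p hp => ?_
  have : NeZero k := (σ p).neZero
  calc dist p (S (g (σ p))) ≤ dist p (A (σ p)) + dist (A (σ p)) (S (g (σ p))) :=
        dist_triangle _ _ _
    _ ≤ dist p (A (σ p)) + 3 * (dist (A (σ p)) p + ptCost p S) := by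
        gcongr
        exact (mem_nearCenters.mp (hg (σ p))).trans
          (mul_le_mul_of_nonneg_left (ptCost_le_dist_add_ptCost _ _ _) zero_le_three)
    _ = 3 * ptCost p S + 4 * ptCost p A := by
        rw [ptCost_eq_of_isNearest hσ hp, dist_comm (A (σ p))]
        ring

theorem card_ambiguous_mul_opt_le {P : Finset (Pt d)} {β : ℝ} (hβ : 0 ≤ β)
    (hst : IsStable P k β) {A : Fin k → Pt d} {σ : Pt d → Fin k} (hσ : IsNearest P A σ)
    (S : Fin k → Pt d) :
    ((ambiguous A S).card : ℝ) * (β * opt P k) ≤ 8 * (3 * cost P S + 4 * cost P A) := by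
  classical
  rcases (ambiguous A S).eq_empty_or_nonempty with h0 | ⟨j, hj⟩
  · have := cost_nonneg P S
    have := cost_nonneg P A
    rw [h0, Finset.card_empty, Nat.cast_zero, zero_mul]
    positivity
  have hk : 2 ≤ k := by
    simpa using (Finset.mem_filter.mp hj).2.trans (Finset.card_le_univ _)
  have : NeZero k := ⟨by omega⟩
  obtain ⟨D, hD, hcard⟩ := exists_transversal _ fun j => nearCenters_nonempty S (A j)
  rw [Fintype.card_fin, ← ambiguous] at hcard
  choose g hg hgD using hD
  have hx := Finset.card_pos.mpr ⟨j, hj⟩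
  have hT : (D.image S).card ≤ D.card := Finset.card_image_le
  have hstable := mul_opt_le_of_isStable hst hk (T := D.image S) (s := fun p => S (g (σ p)))
    (by omega) fun p _ => Finset.mem_image_of_mem S (hgD _)
  have hcost := sum_dist_nearCenter_le hσ hg
  have hle : ((ambiguous A S).card : ℝ) ≤ 4 * (k - (D.image S).card) := by
    have : (4 * (D.image S).card + (ambiguous A S).card : ℝ) ≤ 4 * k := by
      exact_mod_cast (by omega : 4 * (D.image S).card + (ambiguous A S).card ≤ 4 * k)
    linarith
  have := mul_le_mul_of_nonneg_right hle (mul_nonneg hβ (opt_nonneg P k))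
  linarith

end Geometry

section Codes

open NormedSpace

variable {E : Type*} [NormedAddCommGroup E]

/-- A code for directions: at most `n` greedy steps, each of them a sign and one of the vectors of a
family indexed by `ι`. -/
abbrev DirectionCode (n : ℕ) (ι : Type*) : Type _ := Fin n → Option (ℤˣ × ι)

/-- A code for non-negative numbers: how many of the `T` thresholds of each of `m` scales lie below
the number. -/
abbrev ThresholdCode (m T : ℕ) : Type := Fin (m * T + 1)

theorem abs_norm_sub_norm_mul_norm_add_norm (x y : E) :
    |‖x‖ - ‖y‖| * (‖x‖ + ‖y‖) = |‖x‖ ^ 2 - ‖y‖ ^ 2| := by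
  rw [sq_sub_sq, abs_mul, abs_of_nonneg (by positivity : 0 ≤ ‖x‖ + ‖y‖), mul_comm]

theorem norm_normalize_le_one [NormedSpace ℝ E] (v : E) : ‖normalize v‖ ≤ 1 := by
  rcases eq_or_ne v 0 with rfl | hv
  · simp
  · exact (norm_normalize_eq_one_iff.mpr hv).le

variable [InnerProductSpace ℝ E]

theorem exists_norm_sub_smul_sq_le {e v : E} (he : ‖e‖ ≤ 1) {δ : ℝ} (hδ : 0 < δ)
    (hv : δ < |inner ℝ e v|) : ∃ u : ℤˣ, ‖v - (δ * (u : ℝ)) • e‖ ^ 2 ≤ ‖v‖ ^ 2 - δ ^ 2 := by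
  obtain ⟨u, hu⟩ : ∃ u : ℤˣ, |inner ℝ e v| = u * inner ℝ e v := by
    rcases abs_choice (inner ℝ e v) with h | h
    · exact ⟨1, by simpa using h⟩
    · exact ⟨-1, by simpa using h⟩
  have hnorm : ‖(δ * (u : ℝ)) • e‖ ≤ δ := by
    rw [norm_smul, norm_mul, Real.norm_eq_abs (u : ℝ), abs_intUnit_cast, mul_one,
      Real.norm_of_nonneg hδ.le]
    exact mul_le_of_le_one_right hδ.le he
  refine ⟨u, ?_⟩
  rw [norm_sub_sq_real, real_inner_smul_right, real_inner_comm, mul_assoc, ← hu]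
  nlinarith [pow_le_pow_left₀ (norm_nonneg _) hnorm 2]

/-- As long as some inner product of the residual is large, a greedy step reduces its square norm
by `δ ^ 2`. -/
theorem exists_directionCode_abs_inner_le {ι : Type*} {e : ι → E} (he : ∀ l, ‖e l‖ ≤ 1) {δ : ℝ}
    (hδ : 0 < δ) {n : ℕ} {v : E} (hv : ‖v‖ ^ 2 ≤ n * δ ^ 2) :
    ∃ c : DirectionCode n ι, ∀ l,
      |inner ℝ (e l) (v - ∑ i, (c i).elim 0 fun z => (δ * (z.1 : ℝ)) • e z.2)| ≤ δ := by
  induction n generalizing v with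
  | zero =>
    have : v = 0 := by simpa using hv
    exact ⟨fun _ => none, fun l => by simp [this, hδ.le]⟩
  | succ n ih =>
    by_cases hall : ∀ l, |inner ℝ (e l) v| ≤ δ
    · exact ⟨fun _ => none, fun l => by simpa using hall l⟩
    · push Not at hall
      obtain ⟨l, hl⟩ := hall
      obtain ⟨u, hu⟩ := exists_norm_sub_smul_sq_le (he l) hδ hl
      obtain ⟨c, hc⟩ := ih (v := v - (δ * (u : ℝ)) • e l) (by push_cast at hv; linarith)
      refine ⟨Fin.cons (some (u, l)) c, fun l' => ?_⟩
      simpa only [Fin.sum_univ_succ, Fin.cons_zero, Fin.cons_succ, Option.elim_some, ← sub_sub]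
        using hc l'

theorem exists_directionCode {ι : Type*} (y : ι → E) {δ : ℝ} (hδ : 0 < δ) {n : ℕ}
    (hn : 1 ≤ n * δ ^ 2) :
    ∃ code : E → DirectionCode n ι, ∀ v v', code v = code v' →
      ∀ l, |inner ℝ (y l) (normalize v - normalize v')| ≤ 2 * δ * ‖y l‖ := by
  choose code hcode using fun v => exists_directionCode_abs_inner_le
    (fun l => norm_normalize_le_one (y l)) hδ
    ((pow_le_one₀ (norm_nonneg _) (norm_normalize_le_one v)).trans hn)
  refine ⟨code, fun v v' h l => ?_⟩
  have hv := hcode v l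
  have hv' := hcode v' l
  rw [← h] at hv'
  have hunit : |inner ℝ (normalize (y l)) (normalize v - normalize v')| ≤ 2 * δ := by
    rw [inner_sub_right] at hv hv' ⊢
    rw [abs_le] at *
    constructor <;> linarith
  calc |inner ℝ (y l) (normalize v - normalize v')|
      = ‖y l‖ * |inner ℝ (normalize (y l)) (normalize v - normalize v')| := by
        conv_lhs => rw [← norm_smul_normalize (y l)]
        rw [real_inner_smul_left, abs_mul, abs_norm]
    _ ≤ ‖y l‖ * (2 * δ) := by gcongr
    _ = 2 * δ * ‖y l‖ := mul_comm _ _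

theorem exists_thresholdCode {m : ℕ} {ρ : Fin m → ℝ} (hρ : ∀ i, 0 ≤ ρ i) {δ : ℝ} (hδ : 0 < δ)
    (T : ℕ) :
    ∃ code : ℝ → ThresholdCode m T, ∀ y y', 0 ≤ y → 0 ≤ y' → code y = code y' →
      ∀ i, |y - y'| ≤ δ * ρ i ∨ (T * (δ * ρ i) ≤ y ∧ T * (δ * ρ i) ≤ y') := by
  let below (y : ℝ) : Finset (Fin m × Fin T) :=
    Finset.univ.filter fun z => ((z.2 : ℕ) + 1 : ℝ) * (δ * ρ z.1) ≤ y
  have hbelow (y : ℝ) : (below y).card < m * T + 1 := by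
    simpa [Nat.lt_succ_iff] using Finset.card_le_univ (below y)
  have hmono {y y' : ℝ} (h : y ≤ y') : below y ⊆ below y' :=
    Finset.monotone_filter_right _ fun z _ hz => hz.trans h
  have hordered (y y' : ℝ) (h0 : 0 ≤ y) (hle : y ≤ y') (hcard : (below y).card = (below y').card)
      (i : Fin m) : |y - y'| ≤ δ * ρ i ∨ (T * (δ * ρ i) ≤ y ∧ T * (δ * ρ i) ≤ y') := by
    have heq : below y = below y' := Finset.eq_of_subset_of_card_le (hmono hle) hcard.ge
    refine or_iff_not_imp_right.mpr fun hT => ?_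
    have hlt : y < T * (δ * ρ i) := not_le.mp fun h => hT ⟨h, h.trans hle⟩
    have hpos : 0 < δ * ρ i :=
      (mul_nonneg hδ.le (hρ i)).lt_of_ne fun h => by rw [← h, mul_zero] at hlt; linarith
    have hfloor : ⌊y / (δ * ρ i)⌋₊ < T :=
      (Nat.floor_lt (by positivity)).mpr ((div_lt_iff₀ hpos).mpr hlt)
    have hlow : (⌊y / (δ * ρ i)⌋₊ : ℝ) * (δ * ρ i) ≤ y :=
      (le_div_iff₀ hpos).mp (Nat.floor_le (by positivity))
    have hnext : (i, (⟨_, hfloor⟩ : Fin T)) ∉ below y' := by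
      rw [← heq]
      simpa [below] using (div_lt_iff₀ hpos).mp (Nat.lt_floor_add_one (y / (δ * ρ i)))
    simp only [below, Finset.mem_filter, Finset.mem_univ, true_and, not_le] at hnext
    rw [abs_sub_comm, abs_of_nonneg (by linarith)]
    linarith
  refine ⟨fun y => ⟨(below y).card, hbelow y⟩, fun y y' h0 h0' h i => ?_⟩
  have hcard : (below y).card = (below y').card := Fin.mk.inj h
  rcases le_total y y' with hle | hle
  · exact hordered y y' h0 hle hcard i
  · rw [abs_sub_comm, and_comm]
    exact hordered y' y h0' hle hcard.symm i

theorem abs_inner_sub_le (x v v' : E) :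
    |inner ℝ x (v - v')| ≤
      |‖v‖ - ‖v'‖| * ‖x‖ + ‖v'‖ * |inner ℝ x (normalize v - normalize v')| := by
  have hsplit : v - v' = (‖v‖ - ‖v'‖) • normalize v + ‖v'‖ • (normalize v - normalize v') := by
    rw [sub_smul, smul_sub, norm_smul_normalize, norm_smul_normalize]
    abel
  rw [hsplit, inner_add_right, real_inner_smul_right, real_inner_smul_right]
  refine (abs_add_le _ _).trans (add_le_add ?_ (by rw [abs_mul, abs_norm]))
  rw [abs_mul]
  gcongr
  exact (abs_real_inner_le_norm _ _).trans
    (mul_le_of_le_one_right (norm_nonneg _) (norm_normalize_le_one v))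

/-- The distances of `v` and `v'` to the origin and to `x` are compared through their squares; the
origin is at least as close to `v` and `v'` as `x`. -/
theorem abs_norm_sub_sub_norm_sub_le {x v v' : E} {δ ρ : ℝ} (hδ : 0 < δ) (hρ : 0 < ρ)
    (hv : ‖v‖ ≤ ‖v - x‖) (hv' : ‖v'‖ ≤ ‖v' - x‖) (hvρ : ‖v'‖ ≤ 33 * ρ)
    (hnorm : |‖v‖ - ‖v'‖| ≤ δ * ρ)
    (hdir : |inner ℝ x (normalize v - normalize v')| ≤ 2 * δ * ‖x‖) :
    |‖v - x‖ - ‖v' - x‖| ≤ 135 * δ * ρ := by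
  set D := ‖v - x‖
  set D' := ‖v' - x‖
  have hD : 0 ≤ D := norm_nonneg _
  have hD' : 0 ≤ D' := norm_nonneg _
  have hx : ‖x‖ ≤ D + D' := by
    have h := norm_sub_le v (v - x)
    have h' := norm_sub_le v' (v' - x)
    rw [sub_sub_cancel] at h h'
    linarith
  have hinner : |inner ℝ x (v - v')| ≤ 67 * (δ * ρ) * (D + D') :=
    calc |inner ℝ x (v - v')|
        ≤ |‖v‖ - ‖v'‖| * ‖x‖ + ‖v'‖ * |inner ℝ x (normalize v - normalize v')| :=
          abs_inner_sub_le x v v'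
      _ ≤ δ * ρ * (D + D') + 33 * ρ * (2 * δ * (D + D')) := by
          have := hdir.trans (mul_le_mul_of_nonneg_left hx (by positivity))
          gcongr
      _ = 67 * (δ * ρ) * (D + D') := by ring
  have hsq : D ^ 2 - D' ^ 2 = (‖v‖ - ‖v'‖) * (‖v‖ + ‖v'‖) - 2 * inner ℝ x (v - v') := by
    rw [norm_sub_sq_real, norm_sub_sq_real, inner_sub_right, real_inner_comm v x,
      real_inner_comm v' x]
    ring
  have hprod : |D - D'| * (D + D') ≤ 135 * δ * ρ * (D + D') := by
    rw [abs_norm_sub_norm_mul_norm_add_norm, hsq]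
    calc |(‖v‖ - ‖v'‖) * (‖v‖ + ‖v'‖) - 2 * inner ℝ x (v - v')|
        ≤ |‖v‖ - ‖v'‖| * (‖v‖ + ‖v'‖) + 2 * |inner ℝ x (v - v')| := by
          refine (abs_sub _ _).trans_eq ?_
          rw [abs_mul, abs_mul, abs_two, abs_of_nonneg (by positivity : 0 ≤ ‖v‖ + ‖v'‖)]
      _ ≤ δ * ρ * (D + D') + 2 * (67 * (δ * ρ) * (D + D')) := by gcongr
      _ = 135 * δ * ρ * (D + D') := by ring
  rcases (add_nonneg hD hD').eq_or_lt with h0 | h0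
  · rw [show D = D' by linarith, sub_self, abs_zero]
    positivity
  · exact le_of_mul_le_mul_right hprod h0

/-- A code for points of a space with terminals indexed by `ι`: a nearest terminal, and the distance
and direction from there. -/
abbrev DistanceCode (m n T : ℕ) (ι : Type*) : Type _ := ι × ThresholdCode m T × DirectionCode n ι

theorem exists_distanceCode {ι : Type*} [Finite ι] [Nonempty ι] (y : ι → E) {m : ℕ}
    {ρ : Fin m → ℝ} (hρ : ∀ i, 0 ≤ ρ i) {δ : ℝ} (hδ : 0 < δ) (hδ1 : δ ≤ 1) {n : ℕ}
    (hn : 1 ≤ n * δ ^ 2) {T : ℕ} (hT : 33 ≤ T * δ) :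
    ∃ code : E → DistanceCode m n T ι, ∀ s s', code s = code s' →
      ∀ l i, 0 < ρ i → dist (y l) s ≤ 32 * ρ i ∨ dist (y l) s' ≤ 32 * ρ i →
        |dist (y l) s - dist (y l) s'| ≤ 135 * δ * ρ i := by
  suffices hone : ∃ code : E → DistanceCode m n T ι, ∀ s s', code s = code s' →
      ∀ l i, 0 < ρ i → dist (y l) s ≤ 32 * ρ i →
        |dist (y l) s - dist (y l) s'| ≤ 135 * δ * ρ i by
    obtain ⟨code, hcode⟩ := hone
    exact ⟨code, fun s s' h l i hi => or_imp.mpr ⟨hcode s s' h l i hi,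
      fun hd => (abs_sub_comm _ _).trans_le (hcode s' s h.symm l i hi hd)⟩⟩
  obtain ⟨τ, hτ⟩ := exists_thresholdCode hρ hδ T
  choose l₀ hl₀ using fun s : E => Finite.exists_min fun l => dist (y l) s
  choose G hG using fun a => exists_directionCode (fun l => y l - y a) hδ hn
  refine ⟨fun s => (l₀ s, τ ‖s - y (l₀ s)‖, G (l₀ s) (s - y (l₀ s))), fun s s' h l i hi hd => ?_⟩
  simp only [Prod.mk.injEq] at h
  obtain ⟨hterm, hthr, hdir⟩ := h
  rw [← hterm] at hthr hdir
  set a := y (l₀ s)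
  have hdist (z : E) : dist (y l) z = ‖(z - a) - (y l - a)‖ := by
    rw [dist_comm, dist_eq_norm, sub_sub_sub_cancel_right]
  have hmin : ‖s - a‖ ≤ dist (y l) s := by
    rw [← dist_eq_norm, dist_comm]
    exact hl₀ s l
  have hmin' : ‖s' - a‖ ≤ dist (y l) s' := by
    rw [← dist_eq_norm, dist_comm, show a = y (l₀ s') by rw [← hterm]]
    exact hl₀ s' l
  have hnorm : |‖s - a‖ - ‖s' - a‖| ≤ δ * ρ i := by
    refine (hτ _ _ (norm_nonneg _) (norm_nonneg _) hthr i).resolve_right fun h => ?_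
    nlinarith [h.1]
  rw [hdist] at hd hmin
  rw [hdist] at hmin'
  rw [hdist, hdist]
  refine abs_norm_sub_sub_norm_sub_le hδ hi hmin hmin' ?_ hnorm (hG _ _ _ hdir l)
  nlinarith [abs_le.mp hnorm]

theorem abs_norm_sub_sub_norm_sub_mul_le {z w w' : E} (hw : ‖w‖ = ‖w'‖) (hz : 4 * ‖z‖ ≤ ‖w‖) :
    |‖w - z‖ - ‖w' - z‖| * (3 * ‖w‖) ≤ 4 * |inner ℝ z (w - w')| := by
  have hsq : ‖w - z‖ ^ 2 - ‖w' - z‖ ^ 2 = -2 * inner ℝ z (w - w') := by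
    rw [norm_sub_sq_real, norm_sub_sq_real, inner_sub_right, real_inner_comm z w,
      real_inner_comm z w', hw]
    ring
  have hlow := norm_sub_norm_le w z
  have hlow' := norm_sub_norm_le w' z
  calc |‖w - z‖ - ‖w' - z‖| * (3 * ‖w‖)
      ≤ |‖w - z‖ - ‖w' - z‖| * (2 * (‖w - z‖ + ‖w' - z‖)) :=
        mul_le_mul_of_nonneg_left (by rw [← hw] at hlow'; linarith) (abs_nonneg _)
    _ = 4 * |inner ℝ z (w - w')| := by
        rw [mul_left_comm, abs_norm_sub_norm_mul_norm_add_norm, hsq, abs_mul, abs_neg, abs_two]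
        ring

theorem abs_norm_sub_sub_norm_add_inner_mul_le (v z : E) :
    |‖v - z‖ - ‖v‖ + inner ℝ z (normalize v)| * ‖v‖ ≤ 2 * ‖z‖ ^ 2 := by
  set c := inner ℝ z (normalize v)
  have hc : |c| ≤ ‖z‖ := (abs_real_inner_le_norm _ _).trans
    (mul_le_of_le_one_right (norm_nonneg _) (norm_normalize_le_one v))
  have hdiff : |‖v - z‖ - ‖v‖| ≤ ‖z‖ := by
    simpa using abs_norm_sub_norm_le (v - z) v
  have hinner : inner ℝ v z = ‖v‖ * c := by
    rw [real_inner_comm, ← real_inner_smul_right, norm_smul_normalize]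
  have hexp : (‖v - z‖ - ‖v‖ + c) * (‖v - z‖ + ‖v‖) = ‖z‖ ^ 2 + c * (‖v - z‖ - ‖v‖) := by
    have := norm_sub_sq_real v z
    rw [hinner] at this
    linear_combination this
  calc |‖v - z‖ - ‖v‖ + c| * ‖v‖ ≤ |‖v - z‖ - ‖v‖ + c| * (‖v - z‖ + ‖v‖) := by
        gcongr
        exact le_add_of_nonneg_left (norm_nonneg _)
    _ = |‖z‖ ^ 2 + c * (‖v - z‖ - ‖v‖)| := by
        rw [← hexp, abs_mul, abs_of_nonneg (by positivity : 0 ≤ ‖v - z‖ + ‖v‖)]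
    _ ≤ ‖z‖ ^ 2 + |c| * |‖v - z‖ - ‖v‖| := by
        refine (abs_add_le _ _).trans_eq ?_
        rw [abs_mul, abs_of_nonneg (sq_nonneg ‖z‖)]
    _ ≤ ‖z‖ ^ 2 + ‖z‖ * ‖z‖ := by gcongr
    _ = 2 * ‖z‖ ^ 2 := by ring

theorem abs_shift_sub_shift_le_of_close {z v v' : E} {δ ρ : ℝ} (hδ : 0 ≤ δ) (hz : ‖z‖ ≤ ρ)
    (hv : 4 * ρ < ‖v‖) (hv' : 4 * ρ < ‖v'‖) (hnorm : |‖v‖ - ‖v'‖| ≤ δ * ρ)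
    (hdir : |inner ℝ z (normalize v - normalize v')| ≤ 2 * δ * ρ) :
    |(‖v - z‖ - ‖v‖) - (‖v' - z‖ - ‖v'‖)| ≤ 6 * δ * ρ := by
  have hρ : 0 ≤ ρ := (norm_nonneg z).trans hz
  have hunit : ‖normalize v‖ = 1 :=
    norm_normalize_eq_one_iff.mpr (norm_pos_iff.mp (by linarith))
  let w := ‖v'‖ • normalize v
  have hw : ‖w‖ = ‖v'‖ := by rw [norm_smul, hunit, mul_one, norm_norm]
  have hvw : |‖v - z‖ - ‖w - z‖| ≤ δ * ρ := by
    refine (abs_norm_sub_norm_le _ _).trans ?_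
    rw [sub_sub_sub_cancel_right]
    nth_rewrite 1 [← norm_smul_normalize v]
    rw [← sub_smul, norm_smul, hunit, mul_one]
    exact hnorm
  have hwv' : |‖w - z‖ - ‖v' - z‖| ≤ 3 * (δ * ρ) := by
    have hinner : |inner ℝ z (w - v')| ≤ ‖v'‖ * (2 * δ * ρ) := by
      rw [← norm_smul_normalize v', ← smul_sub, norm_smul_normalize, real_inner_smul_right,
        abs_mul, abs_norm]
      gcongr
    have h := abs_norm_sub_sub_norm_sub_mul_le (z := z) hw (by linarith)
    rw [hw] at h
    have hpos : 0 < ‖v'‖ := by linarith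
    have : 0 ≤ δ * ρ := mul_nonneg hδ hρ
    refine le_of_mul_le_mul_right ?_ hpos
    nlinarith
  have hsum := abs_add_three (‖v - z‖ - ‖w - z‖) (‖w - z‖ - ‖v' - z‖) (‖v'‖ - ‖v‖)
  rw [abs_sub_comm ‖v'‖] at hsum
  rw [show (‖v - z‖ - ‖v‖) - (‖v' - z‖ - ‖v'‖) =
    (‖v - z‖ - ‖w - z‖) + (‖w - z‖ - ‖v' - z‖) + (‖v'‖ - ‖v‖) by ring]
  nlinarith [mul_nonneg hδ hρ]

theorem abs_shift_sub_shift_le_of_far {z v v' : E} {η ρ : ℝ} (hz : ‖z‖ ≤ ρ) (hv0 : 0 < ‖v‖)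
    (hv0' : 0 < ‖v'‖) (hv : ρ ^ 2 ≤ η * ‖v‖) (hv' : ρ ^ 2 ≤ η * ‖v'‖)
    (hdir : |inner ℝ z (normalize v - normalize v')| ≤ 2 * η) :
    |(‖v - z‖ - ‖v‖) - (‖v' - z‖ - ‖v'‖)| ≤ 6 * η := by
  have hexpand {w : E} (hw0 : 0 < ‖w‖) (hw : ρ ^ 2 ≤ η * ‖w‖) :
      |‖w - z‖ - ‖w‖ + inner ℝ z (normalize w)| ≤ 2 * η := by
    refine le_of_mul_le_mul_right ((abs_norm_sub_sub_norm_add_inner_mul_le w z).trans ?_) hw0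
    nlinarith [pow_le_pow_left₀ (norm_nonneg z) hz 2]
  rw [inner_sub_right] at hdir
  have h := abs_le.mp (hexpand hv0 hv)
  have h' := abs_le.mp (hexpand hv0' hv')
  have hd := abs_le.mp hdir
  rw [abs_le]
  constructor <;> linarith [h.1, h.2, h'.1, h'.2, hd.1, hd.2]

/-- A code for vectors `v` that determines the increments `‖v - z‖ - ‖v‖` for short vectors `z`. -/
abbrev ShiftCode (m n T : ℕ) : Type := ThresholdCode m T × DirectionCode n (Fin m)

theorem exists_shiftCode {m : ℕ} (z : Fin m → E) {ρ : Fin m → ℝ} (hz : ∀ i, ‖z i‖ ≤ ρ i) {δ : ℝ}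
    (hδ : 0 < δ) {n : ℕ} (hn : 1 ≤ n * δ ^ 2) {T : ℕ} (hT : 1 ≤ T * δ ^ 2) :
    ∃ code : E → ShiftCode m n T, ∀ v v', code v = code v' →
      ∀ i, 4 * ρ i < ‖v‖ → 4 * ρ i < ‖v'‖ →
        |(‖v - z i‖ - ‖v‖) - (‖v' - z i‖ - ‖v'‖)| ≤ 6 * δ * ρ i := by
  have hρ (i : Fin m) : 0 ≤ ρ i := (norm_nonneg _).trans (hz i)
  obtain ⟨τ, hτ⟩ := exists_thresholdCode hρ hδ T
  obtain ⟨G, hG⟩ := exists_directionCode z hδ hn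
  refine ⟨fun v => (τ ‖v‖, G v), fun v v' h i hv hv' => ?_⟩
  obtain ⟨hthr, hcode⟩ := Prod.mk.inj h
  have hdir : |inner ℝ (z i) (normalize v - normalize v')| ≤ 2 * δ * ρ i :=
    (hG v v' hcode i).trans (mul_le_mul_of_nonneg_left (hz i) (by positivity))
  rcases hτ _ _ (norm_nonneg _) (norm_nonneg _) hthr i with hclose | ⟨hfar, hfar'⟩
  · exact abs_shift_sub_shift_le_of_close hδ.le (hz i) hv hv' hclose hdir
  · have hlong {w : E} (hw : T * (δ * ρ i) ≤ ‖w‖) : ρ i ^ 2 ≤ δ * ρ i * ‖w‖ :=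
      calc ρ i ^ 2 ≤ T * δ ^ 2 * ρ i ^ 2 := le_mul_of_one_le_left (sq_nonneg _) hT
        _ = δ * ρ i * (T * (δ * ρ i)) := by ring
        _ ≤ δ * ρ i * ‖w‖ := mul_le_mul_of_nonneg_left hw (mul_nonneg hδ.le (hρ i))
    rw [mul_assoc]
    have := hρ i
    exact abs_shift_sub_shift_le_of_far (hz i) (by linarith) (by linarith) (hlong hfar)
      (hlong hfar') (by rwa [← mul_assoc])

end Codes

section Nets

variable {d k m : ℕ}

/-- The cost of `q` relative to a reference point `a`. Unlike the cost itself it is bounded by the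
distance of `q` to `a`, uniformly in the solution `S`. -/
noncomputable def relCost (a q : Pt d) (S : Fin k → Pt d) : ℝ := ptCost q S - ptCost a S

theorem abs_relCost_le [NeZero k] (a q : Pt d) (S : Fin k → Pt d) :
    |relCost a q S| ≤ dist q a :=
  abs_sub_le_iff.mpr
    ⟨sub_le_iff_le_add.mpr (ptCost_le_dist_add_ptCost q a S),
      sub_le_iff_le_add.mpr (dist_comm q a ▸ ptCost_le_dist_add_ptCost a q S)⟩

theorem ptCost_le_ptCost_add [NeZero k] {q : Pt d} {r η : ℝ} {S S' : Fin k → Pt d}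
    (h : ∀ s, dist q (S s) ≤ r → |dist q (S s) - dist q (S' s)| ≤ η) (hr : ptCost q S ≤ r) :
    ptCost q S' ≤ ptCost q S + η := by
  obtain ⟨s, hs⟩ := exists_dist_eq_ptCost q S
  linarith [(abs_le.mp (h s (hs.trans_le hr))).1, ptCost_le_dist q S' s]

theorem abs_ptCost_sub_ptCost_le [NeZero k] {q : Pt d} {r η : ℝ} {S S' : Fin k → Pt d}
    (h : ∀ s, dist q (S s) ≤ r ∨ dist q (S' s) ≤ r → |dist q (S s) - dist q (S' s)| ≤ η)
    (hη : 0 ≤ η) (hr : ptCost q S + η ≤ r) : |ptCost q S - ptCost q S'| ≤ η := by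
  have hS' := ptCost_le_ptCost_add (fun s hs => h s (.inl hs)) (by linarith)
  have hS := ptCost_le_ptCost_add (fun s hs => (abs_sub_comm _ _).trans_le (h s (.inr hs)))
    (hS'.trans hr)
  exact abs_sub_le_iff.mpr ⟨by linarith, by linarith⟩

theorem abs_relCost_sub_relCost_le_of_dist_close [NeZero k] {a q : Pt d} {r η : ℝ}
    {S S' : Fin k → Pt d}
    (ha : ∀ s, dist a (S s) ≤ r ∨ dist a (S' s) ≤ r → |dist a (S s) - dist a (S' s)| ≤ η)
    (hq : ∀ s, dist q (S s) ≤ r ∨ dist q (S' s) ≤ r → |dist q (S s) - dist q (S' s)| ≤ η)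
    (hη : 0 ≤ η) (hr : dist q a + ptCost a S + η ≤ r) :
    |relCost a q S - relCost a q S'| ≤ 2 * η := by
  have hcost := ptCost_le_dist_add_ptCost q a S
  have hclose_a := abs_sub_le_iff.mp
    (abs_ptCost_sub_ptCost_le ha hη (by linarith [dist_nonneg (x := q) (y := a)]))
  have hclose_q := abs_sub_le_iff.mp (abs_ptCost_sub_ptCost_le hq hη (by linarith))
  unfold relCost
  exact abs_sub_le_iff.mpr
    ⟨by linarith [hclose_a.2, hclose_q.1], by linarith [hclose_a.1, hclose_q.2]⟩

theorem relCost_le_relCost_add [NeZero k] {a q : Pt d} {r η ξ : ℝ} {S S' : Fin k → Pt d}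
    (hr : 2 * dist q a < r)
    (hshift : ∀ s,
      |(dist q (S s) - dist a (S s)) - (dist q (S' s) - dist a (S' s))| ≤ η)
    (hgap : ∀ s, |(dist a (S s) - ptCost a S) - (dist a (S' s) - ptCost a S')| ≤ ξ ∨
      r ≤ dist a (S s) - ptCost a S) :
    relCost a q S' ≤ relCost a q S + η + ξ := by
  obtain ⟨s, hs⟩ := exists_dist_eq_ptCost q S
  have hnear : dist a (S s) - ptCost a S ≤ 2 * dist q a := by
    have := dist_triangle_left a (S s) q
    linarith [ptCost_le_dist_add_ptCost q a S]
  have hgap_s := abs_le.mp ((hgap s).resolve_right (hnear.trans_lt hr).not_ge)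
  have hshift_s := abs_le.mp (hshift s)
  have := ptCost_le_dist q S' s
  unfold relCost
  linarith [hgap_s.1, hshift_s.1]

theorem abs_relCost_sub_relCost_le_of_shift_close [NeZero k] {a q : Pt d} {r η ξ : ℝ}
    {S S' : Fin k → Pt d} (hr : 2 * dist q a < r)
    (hshift : ∀ s,
      |(dist q (S s) - dist a (S s)) - (dist q (S' s) - dist a (S' s))| ≤ η)
    (hgap : ∀ s, |(dist a (S s) - ptCost a S) - (dist a (S' s) - ptCost a S')| ≤ ξ ∨
      (r ≤ dist a (S s) - ptCost a S ∧ r ≤ dist a (S' s) - ptCost a S')) :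
    |relCost a q S - relCost a q S'| ≤ η + ξ := by
  have h := relCost_le_relCost_add hr hshift fun s => (hgap s).imp_right And.left
  have h' := relCost_le_relCost_add hr (fun s => (abs_sub_comm _ _).trans_le (hshift s))
    fun s => (hgap s).imp (abs_sub_comm _ _).trans_le And.right
  exact abs_sub_le_iff.mpr ⟨by linarith, by linarith⟩

theorem ptCost_eq_dist_of_card_nearCenters_lt_two [NeZero k] {a q : Pt d} {S : Fin k → Pt d}
    (hq : dist q a ≤ ptCost a S) (hcard : (nearCenters S a).card < 2) {s : Fin k}
    (hs : dist a (S s) = ptCost a S) : ptCost q S = dist q (S s) := by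
  obtain ⟨s', hs'⟩ := exists_dist_eq_ptCost q S
  have hmem : s ∈ nearCenters S a :=
    mem_nearCenters.mpr (by linarith [ptCost_nonneg a S])
  have hmem' : s' ∈ nearCenters S a := by
    have := dist_triangle_left a (S s') q
    exact mem_nearCenters.mpr (by linarith [ptCost_le_dist_add_ptCost q a S])
  rw [← hs', Finset.card_le_one.mp (Nat.le_of_lt_succ hcard) s' hmem' s hmem]

theorem abs_relCost_sub_relCost_le_of_card_nearCenters_lt_two [NeZero k] {a q : Pt d} {η : ℝ}
    {S S' : Fin k → Pt d} (hq : dist q a ≤ ptCost a S) (hq' : dist q a ≤ ptCost a S')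
    (hcard : (nearCenters S a).card < 2) (hcard' : (nearCenters S' a).card < 2) {s s' : Fin k}
    (hs : dist a (S s) = ptCost a S) (hs' : dist a (S' s') = ptCost a S')
    (hshift : |(dist q (S s) - dist a (S s)) - (dist q (S' s') - dist a (S' s'))| ≤ η) :
    |relCost a q S - relCost a q S'| ≤ η := by
  rwa [relCost, relCost, ptCost_eq_dist_of_card_nearCenters_lt_two hq hcard hs,
    ptCost_eq_dist_of_card_nearCenters_lt_two hq' hcard' hs', ← hs, ← hs']

theorem exists_list_of_ambiguous [NeZero k] (A S : Fin k → Pt d) (x : ℕ) :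
    ∃ e : Fin x → Fin k, (ambiguous A S).card ≤ x →
      ∀ j, (∃ t, e t = j) ∨ (nearCenters S (A j)).card < 2 := by
  set X := ambiguous A S
  refine ⟨fun t => if h : (t : ℕ) < X.card then X.equivFin.symm ⟨t, h⟩ else 0, fun hx j => ?_⟩
  refine or_iff_not_imp_right.mpr fun hj => ?_
  have hmem : j ∈ X := Finset.mem_filter.mpr ⟨Finset.mem_univ j, not_lt.mp hj⟩
  exact ⟨⟨X.equivFin ⟨j, hmem⟩, (X.equivFin ⟨j, hmem⟩).isLt.trans_le hx⟩, by simp⟩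

theorem exists_shiftCode_dist {q a : Fin m → Pt d} {ρ : Fin m → ℝ}
    (hρ : ∀ i, dist (q i) (a i) ≤ ρ i) {δ : ℝ} (hδ : 0 < δ) {n : ℕ} (hn : 1 ≤ n * δ ^ 2) {T : ℕ}
    (hT : 1 ≤ T * δ ^ 2) :
    ∃ code : Pt d → ShiftCode m n T, ∀ i s s', code (s - a i) = code (s' - a i) →
      4 * ρ i < dist (a i) s → 4 * ρ i < dist (a i) s' →
        |(dist (q i) s - dist (a i) s) - (dist (q i) s' - dist (a i) s')| ≤ 6 * δ * ρ i := by
  obtain ⟨code, hcode⟩ := exists_shiftCode (fun i => q i - a i)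
    (fun i => (dist_eq_norm (q i) (a i)).ge.trans (hρ i)) hδ hn hT
  refine ⟨code, fun i s s' h hs hs' => ?_⟩
  have hdist (b s : Pt d) : dist b s = ‖s - b‖ := dist_eq_norm' b s
  have := hcode _ _ h i (by rwa [← hdist]) (by rwa [← hdist])
  simpa only [sub_sub_sub_cancel_right, ← hdist] using this

/-- A code for `k`-tuples of centers, with respect to `k` reference points and `m` sample points. It
records the position of every center (for the sample points near their reference point), the
nearest center of every reference point, a list of `x` reference points, and the positions of all
centers as seen from the reference points of the list. -/
abbrev CenterCode (m k n T x : ℕ) : Type :=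
  (Fin k → DistanceCode m n T (Bool × Fin m)) × (Fin k → Fin k × ShiftCode m n T) ×
    (Fin x → Fin k) × (Fin x → Fin k → ShiftCode m n T × ThresholdCode m T)

theorem natCard_centerCode_le {m k n T x B : ℕ} (hm : 4 * m + 1 ≤ B) (hT : m * T + 1 ≤ B)
    (hk : k ≤ B) : Nat.card (CenterCode m k n T x) ≤ B ^ ((n + 2) * (k * (2 + x)) + x) := by
  have hthreshold : Nat.card (ThresholdCode m T) ≤ B := by
    rwa [Nat.card_fin]
  have hdirection {ι : Type} [Finite ι] (hι : 2 * Nat.card ι + 1 ≤ B) :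
      Nat.card (DirectionCode n ι) ≤ B ^ n := by
    rw [Nat.card_fun, Nat.card_fin, Finite.card_option, Nat.card_prod, Nat.card_eq_fintype_card]
    exact Nat.pow_le_pow_left (by rwa [Fintype.card_units_int]) n
  have hshift : Nat.card (ShiftCode m n T) ≤ B * B ^ n := by
    rw [Nat.card_prod]
    exact Nat.mul_le_mul hthreshold (hdirection (by rw [Nat.card_fin]; omega))
  have hbool : Nat.card (Bool × Fin m) = 2 * m := by simp
  have hdistance : Nat.card (DistanceCode m n T (Bool × Fin m)) ≤ B * (B * B ^ n) := by
    rw [Nat.card_prod, Nat.card_prod (ThresholdCode m T), hbool]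
    exact Nat.mul_le_mul (by omega)
      (Nat.mul_le_mul hthreshold (hdirection (by rw [hbool]; omega)))
  calc Nat.card (CenterCode m k n T x)
      = Nat.card (DistanceCode m n T (Bool × Fin m)) ^ k *
          ((k * Nat.card (ShiftCode m n T)) ^ k *
            (k ^ x * ((Nat.card (ShiftCode m n T) * Nat.card (ThresholdCode m T)) ^ k) ^ x)) := by
        simp only [CenterCode, Nat.card_prod, Nat.card_fun, Nat.card_fin]
    _ ≤ (B * (B * B ^ n)) ^ k *
          ((B * (B * B ^ n)) ^ k * (B ^ x * ((B * B ^ n * B) ^ k) ^ x)) := by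
        gcongr
    _ = B ^ ((n + 2) * (k * (2 + x)) + x) := by
        simp only [← pow_succ, ← pow_succ', ← pow_mul, ← pow_add]
        congr 1
        ring

theorem abs_relCost_sub_relCost_le_of_near_or_far [NeZero k] {a q : Pt d} {ρ δ : ℝ}
    {S S' : Fin k → Pt d} (hq : dist q a ≤ ρ) (hδ : 0 ≤ δ) (hδ8 : δ ≤ 1 / 8)
    (hclose : 0 < ρ → ∀ z ∈ ({q, a} : Set (Pt d)), ∀ s,
      dist z (S s) ≤ 32 * ρ ∨ dist z (S' s) ≤ 32 * ρ →
        |dist z (S s) - dist z (S' s)| ≤ 135 * δ * ρ)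
    (hfar : 0 < ρ → 4 * ρ < ptCost a S → 4 * ρ < ptCost a S' →
      |relCost a q S - relCost a q S'| ≤ 270 * δ * ρ) :
    |relCost a q S - relCost a q S'| ≤ 270 * δ * ρ := by
  rcases (dist_nonneg.trans hq).eq_or_lt with hρ | hρ
  · have hzero (U : Fin k → Pt d) : relCost a q U = 0 :=
      abs_nonpos_iff.mp ((abs_relCost_le a q U).trans (hq.trans hρ.ge))
    simp [hzero, ← hρ]
  replace hclose := hclose hρ
  have hδρ : 0 ≤ 135 * δ * ρ := by positivity
  have hradius {c : ℝ} (hc : c ≤ 4 * ρ) : dist q a + c + 135 * δ * ρ ≤ 32 * ρ := by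
    nlinarith
  have htwo : 270 * δ * ρ = 2 * (135 * δ * ρ) := by ring
  rcases le_or_gt (ptCost a S) (4 * ρ) with hS | hS
  · rw [htwo]
    exact abs_relCost_sub_relCost_le_of_dist_close (hclose a (by simp)) (hclose q (by simp)) hδρ
      (hradius hS)
  rcases le_or_gt (ptCost a S') (4 * ρ) with hS' | hS'
  · rw [htwo, abs_sub_comm]
    refine abs_relCost_sub_relCost_le_of_dist_close (fun s hs => ?_) (fun s hs => ?_) hδρ
      (hradius hS')
    · exact (abs_sub_comm _ _).trans_le (hclose a (by simp) s hs.symm)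
    · exact (abs_sub_comm _ _).trans_le (hclose q (by simp) s hs.symm)
  exact hfar hρ hS hS'

theorem exists_centerCode [NeZero k] [NeZero m] (q : Fin m → Pt d) (A : Fin k → Pt d)
    (c : Fin m → Fin k) {ρ : Fin m → ℝ} (hρ : ∀ i, dist (q i) (A (c i)) ≤ ρ i) {δ : ℝ}
    (hδ : 0 < δ) (hδ8 : δ ≤ 1 / 8) {n : ℕ} (hn : 1 ≤ n * δ ^ 2) {T : ℕ} (hT : 33 ≤ T * δ ^ 2)
    (x : ℕ) :
    ∃ code : (Fin k → Pt d) → CenterCode m k n T x, ∀ S S', (ambiguous A S).card ≤ x →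
      (ambiguous A S').card ≤ x → code S = code S' →
      ∀ i, |relCost (A (c i)) (q i) S - relCost (A (c i)) (q i) S'| ≤ 270 * δ * ρ i := by
  have hρ0 (i : Fin m) : 0 ≤ ρ i := dist_nonneg.trans (hρ i)
  have hTδ : 33 ≤ T * δ := hT.trans (by gcongr; nlinarith)
  obtain ⟨α, hα⟩ := exists_distanceCode (fun z : Bool × Fin m => if z.1 then q z.2 else A (c z.2))
    hρ0 hδ (by linarith) hn hTδ
  obtain ⟨φ, hφ⟩ := exists_shiftCode_dist hρ hδ hn (by linarith)
  obtain ⟨τ, hτ⟩ := exists_thresholdCode hρ0 hδ T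
  choose f hf using fun (S : Fin k → Pt d) j => exists_dist_eq_ptCost (A j) S
  choose e he using fun S => exists_list_of_ambiguous A S x
  refine ⟨fun S => (fun s => α (S s), fun j => (f S j, φ (S (f S j) - A j)), e S,
    fun t s => (φ (S s - A (e S t)), τ (dist (A (e S t)) (S s) - ptCost (A (e S t)) S))),
    fun S S' hS hS' h i => ?_⟩
  obtain ⟨hposition, hnearest, hlist, hview⟩ : _ ∧ _ ∧ _ ∧ _ := by
    simpa only [Prod.mk.injEq, funext_iff] using h
  refine abs_relCost_sub_relCost_le_of_near_or_far (hρ i) hδ.le hδ8 (fun hρi => ?_)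
    fun hρi hfar hfar' => ?_
  · rintro z (rfl | rfl) s
    · exact hα _ _ (hposition s) (true, i) i hρi
    · exact hα _ _ (hposition s) (false, i) i hρi
  have hshift (s s' : Fin k) (h : φ (S s - A (c i)) = φ (S' s' - A (c i))) :=
    hφ i _ _ h (hfar.trans_le (ptCost_le_dist _ _ _)) (hfar'.trans_le (ptCost_le_dist _ _ _))
  have hδρ : 0 < δ * ρ i := mul_pos hδ hρi
  by_cases hlisted : ∃ t, e S t = c i
  · obtain ⟨t, ht⟩ := hlisted
    have hview_t := hview t
    rw [← hlist t, ht] at hview_t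
    have hfar_T : 2 * dist (q i) (A (c i)) < T * (δ * ρ i) := by
      nlinarith [hρ i, mul_le_mul_of_nonneg_right hTδ hρi.le]
    refine (abs_relCost_sub_relCost_le_of_shift_close hfar_T
      (fun s => hshift s s (hview_t s).1) fun s => hτ _ _ (sub_nonneg.mpr (ptCost_le_dist _ _ _))
        (sub_nonneg.mpr (ptCost_le_dist _ _ _)) (hview_t s).2 i).trans (by linarith)
  · have hcard := (he S hS (c i)).resolve_left hlisted
    have hcard' := (he S' hS' (c i)).resolve_left (by simpa only [← hlist] using hlisted)
    refine (abs_relCost_sub_relCost_le_of_card_nearCenters_lt_two (by linarith [hρ i])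
      (by linarith [hρ i]) hcard hcard' (hf S _) (hf S' _) (hshift _ _ (hnearest _).2)).trans
        (by linarith)

end Nets

section Sample

variable {d k m : ℕ}

theorem exists_representative_ncard_range_le {ι K α : Type*} [Nonempty ι] [Finite K] (code : ι → K)
    (v : ι → α) :
    ∃ r : ι → ι, (∀ t, code (r t) = code t) ∧ (Set.range fun t => v (r t)).ncard ≤ Nat.card K := by
  refine ⟨fun t => Function.invFun code (code t), fun t => Function.apply_invFun_apply, ?_⟩
  calc (Set.range fun t => v (Function.invFun code (code t))).ncard
      ≤ (Set.range fun c => v (Function.invFun code c)).ncard :=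
        Set.ncard_le_ncard (Set.range_comp_subset_range code fun c => v (Function.invFun code c))
    _ ≤ Nat.card K := by
        rw [← Set.image_univ, ← Set.ncard_univ]
        exact Set.ncard_image_le

instance CenterCode.finite {n T x : ℕ} : Finite (CenterCode m k n T x) := by
  have hdirection {ι : Type} [Finite ι] : Finite (DirectionCode n ι) := Pi.finite
  infer_instance

theorem log_four_le_two : Real.log 4 ≤ 2 := by
  rw [show (4 : ℝ) = 2 ^ 2 by norm_num, Real.log_pow]
  push_cast
  linarith [Real.log_two_lt_d9]

theorem log_natCard_centerCode_le [NeZero k] (hkm : k ≤ m) (x : ℕ) {h H : ℕ} (hh : h ≤ H) :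
    Real.log (Nat.card (CenterCode m k (64 * 4 ^ h) (2112 * 4 ^ h) x)) ≤
      4 ^ h * (132 * k * (1 + x) * (Real.log (3000 * m) + 2 * H)) := by
  have hk : 1 ≤ k := NeZero.one_le
  have hm : 0 < m := hk.trans hkm
  have : NeZero m := ⟨hm.ne'⟩
  have h4 : 1 ≤ 4 ^ h := Nat.one_le_pow _ _ (by norm_num)
  have hm4 : m ≤ 4 ^ h * m := Nat.le_mul_of_pos_left _ h4
  have hexp : (64 * 4 ^ h + 2) * (k * (2 + x)) + x ≤ 4 ^ h * (132 * k * (1 + x)) := by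
    have hx : x ≤ 4 ^ h * (k * x) := by
      rw [← mul_assoc]
      exact Nat.le_mul_of_pos_left x (by positivity)
    calc (64 * 4 ^ h + 2) * (k * (2 + x)) + x
        ≤ 66 * 4 ^ h * (k * (2 + x)) + 4 ^ h * (k * x) := by gcongr; omega
      _ = 4 ^ h * (132 * k + 67 * (k * x)) := by ring
      _ ≤ 4 ^ h * (132 * k + 132 * (k * x)) := by gcongr; norm_num
      _ = 4 ^ h * (132 * k * (1 + x)) := by ring
  have hcard : Nat.card (CenterCode m k (64 * 4 ^ h) (2112 * 4 ^ h) x) ≤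
      (3000 * (4 ^ h * m)) ^ (4 ^ h * (132 * k * (1 + x))) :=
    (natCard_centerCode_le (by omega) (by rw [mul_left_comm, mul_comm m]; omega) (by omega)).trans
      (Nat.pow_le_pow_right (by omega) hexp)
  have hlog : Real.log (3000 * (4 ^ h * m)) ≤ Real.log (3000 * m) + 2 * H := by
    have : (0 : ℝ) < m := by exact_mod_cast hm
    rw [mul_left_comm, Real.log_mul (by positivity) (by positivity), Real.log_pow, add_comm]
    have hhH : (h : ℝ) ≤ H := by exact_mod_cast hh
    nlinarith [log_four_le_two]
  calc Real.log (Nat.card (CenterCode m k (64 * 4 ^ h) (2112 * 4 ^ h) x))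
      ≤ Real.log ((3000 * (4 ^ h * m)) ^ (4 ^ h * (132 * k * (1 + x)))) := by
        refine Real.log_le_log (by exact_mod_cast Nat.card_pos) ?_
        exact_mod_cast hcard
    _ = 4 ^ h * (132 * k * (1 + x)) * Real.log (3000 * (4 ^ h * m)) := by
        rw [Real.log_pow]
        push_cast
        rfl
    _ ≤ 4 ^ h * (132 * k * (1 + x)) * (Real.log (3000 * m) + 2 * H) := by gcongr
    _ = 4 ^ h * (132 * k * (1 + x) * (Real.log (3000 * m) + 2 * H)) := by ring

theorem exists_relCost_approximation [NeZero k] (hkm : k ≤ m) (q : Fin m → Pt d)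
    (A : Fin k → Pt d) (c : Fin m → Fin k) {w : Fin m → ℝ} {b : ℝ} (hw : ∀ i, 0 ≤ w i)
    (hwb : ∀ i, w i * dist (q i) (A (c i)) ≤ b) (x : ℕ) {ι : Type*} [Finite ι] [Nonempty ι]
    {S : ι → Fin k → Pt d} (hS : ∀ t, (ambiguous A (S t)).card ≤ x) {h H : ℕ} (hh : h ≤ H) :
    ∃ u : ι → Fin m → ℝ,
      Real.log (Set.range u).ncard ≤
        4 ^ h * (132 * k * (1 + x) * (Real.log (3000 * m) + 2 * H)) ∧
      ∀ t i, |w i * relCost (A (c i)) (q i) (S t) - u t i| ≤ 34 * b / 2 ^ h := by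
  have : NeZero m := ⟨(NeZero.pos k |>.trans_le hkm).ne'⟩
  have h4 : (4 : ℝ) ^ h = (2 ^ h) ^ 2 := by rw [← pow_mul, mul_comm, pow_mul]; norm_num
  have h2 : (1 : ℝ) ≤ 2 ^ h := one_le_pow₀ one_le_two
  obtain ⟨code, hcode⟩ := exists_centerCode q A c (fun i => le_rfl) (δ := 1 / (8 * 2 ^ h))
    (by positivity) (one_div_le_one_div_of_le (by norm_num) (by linarith))
    (n := 64 * 4 ^ h) (by push_cast; rw [h4]; field_simp; norm_num)
    (T := 2112 * 4 ^ h) (by push_cast; rw [h4]; field_simp; norm_num) x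
  obtain ⟨r, hr, hcard⟩ := exists_representative_ncard_range_le (fun t => code (S t))
    fun t i => w i * relCost (A (c i)) (q i) (S t)
  refine ⟨fun t i => w i * relCost (A (c i)) (q i) (S (r t)), ?_, fun t i => ?_⟩
  · refine le_trans (Real.log_le_log ?_ (by exact_mod_cast hcard))
      (log_natCard_centerCode_le hkm x hh)
    exact zero_lt_one.trans_le (one_le_ncard_range _)
  · rw [← mul_sub, abs_mul, abs_of_nonneg (hw i)]
    calc w i * |relCost (A (c i)) (q i) (S t) - relCost (A (c i)) (q i) (S (r t))|
        ≤ w i * (270 * (1 / (8 * 2 ^ h)) * dist (q i) (A (c i))) :=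
          mul_le_mul_of_nonneg_left (hcode _ _ (hS t) (hS (r t)) (hr t).symm i) (hw i)
      _ = 270 / 8 / 2 ^ h * (w i * dist (q i) (A (c i))) := by field_simp
      _ ≤ 270 / 8 / 2 ^ h * b := mul_le_mul_of_nonneg_left (hwb i) (by positivity)
      _ ≤ 34 / 2 ^ h * b := by
          have : 0 ≤ b := (mul_nonneg (hw i) dist_nonneg).trans (hwb i)
          gcongr
          norm_num
      _ = 34 * b / 2 ^ h := by ring

/-- The chaining bound, with scales `1, 1 / 2, …, 1 / 2 ^ H`, for `m` signed relative costs of size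
at most `b`, over solutions with `k` centers and at most `x` ambiguous clusters. The net at scale
`1 / 2 ^ h` has a logarithmic size of `4 ^ h` times the factor after `m` under the root. -/
noncomputable def chainingBound (b : ℝ) (k m x H : ℕ) : ℝ :=
  8 * H * (34 * b) * √(m * (132 * k * (1 + x) * (Real.log (3000 * m) + 2 * H))) +
    34 * b * m / 2 ^ H

theorem chainingBound_mono {b b' : ℝ} (hb : b ≤ b') (k m x H : ℕ) :
    chainingBound b k m x H ≤ chainingBound b' k m x H := by
  unfold chainingBound
  gcongr

theorem chainingBound_mul (c b : ℝ) (k m x H : ℕ) :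
    chainingBound (c * b) k m x H = c * chainingBound b k m x H := by
  unfold chainingBound
  ring

theorem chainingBound_nonneg {b : ℝ} (hb : 0 ≤ b) (k m x H : ℕ) :
    0 ≤ chainingBound b k m x H := by
  unfold chainingBound
  positivity

theorem rademacherAvg_relCost_le [NeZero k] (hkm : k ≤ m) (q : Fin m → Pt d) (A : Fin k → Pt d)
    (c : Fin m → Fin k) {w : Fin m → ℝ} {b : ℝ} (hb : 0 < b) (hw : ∀ i, 0 ≤ w i)
    (hwb : ∀ i, w i * dist (q i) (A (c i)) ≤ b) (x : ℕ) {ι : Type*} [Finite ι] [Nonempty ι]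
    {S : ι → Fin k → Pt d} (hS : ∀ t, (ambiguous A (S t)).card ≤ x) (H : ℕ) :
    rademacherAvg (fun t i => w i * relCost (A (c i)) (q i) (S t)) ≤ chainingBound b k m x H := by
  have hk : (1 : ℝ) ≤ k := by exact_mod_cast NeZero.one_le
  have hm : (1 : ℝ) ≤ m := hk.trans (by exact_mod_cast hkm)
  have : NeZero m := ⟨by rintro rfl; norm_num at hm⟩
  have hlog : 1 ≤ Real.log (3000 * m) := by
    rw [Real.le_log_iff_exp_le (by positivity)]
    linarith [Real.exp_one_lt_d9]
  have hΛ : (1 : ℝ) ≤ 132 * k * (1 + x) * (Real.log (3000 * m) + 2 * H) := by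
    have : (0 : ℝ) ≤ H := H.cast_nonneg
    have : (0 : ℝ) ≤ x := x.cast_nonneg
    exact one_le_mul_of_one_le_of_one_le (by nlinarith) (by linarith)
  have h := rademacherAvg_le_of_approximations (b := 34 * b) (by positivity) hΛ (fun t i => ?_) H
    fun h hh => exists_relCost_approximation hkm q A c hw hwb x hS hh
  · rwa [Fintype.card_fin] at h
  · rw [abs_mul, abs_of_nonneg (hw i)]
    linarith [hwb i, mul_le_mul_of_nonneg_left (abs_relCost_le (A (c i)) (q i) (S t)) (hw i)]

end Sample

section Scores

variable {d k : ℕ} {P : Finset (Pt d)} {A : Fin k → Pt d} {σ : Pt d → Fin k} {p : Pt d}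

theorem mem_cluster {j : Fin k} : p ∈ cluster P σ j ↔ p ∈ P ∧ σ p = j :=
  Finset.mem_filter

theorem card_cluster_pos (hp : p ∈ P) : 0 < (cluster P σ (σ p)).card :=
  Finset.card_pos.mpr ⟨p, mem_cluster.mpr ⟨hp, rfl⟩⟩

theorem sum_sum_cluster (P : Finset (Pt d)) (σ : Pt d → Fin k) (g : Pt d → ℝ) :
    ∑ j, ∑ p ∈ cluster P σ j, g p = ∑ p ∈ P, g p :=
  Finset.sum_fiberwise _ _ _

theorem sum_comp_assignment (P : Finset (Pt d)) (σ : Pt d → Fin k) (g : Fin k → ℝ) :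
    ∑ p ∈ P, g (σ p) = ∑ j, (cluster P σ j).card * g j := by
  rw [← sum_sum_cluster P σ]
  refine Finset.sum_congr rfl fun j _ => ?_
  rw [Finset.sum_congr rfl fun p hp => congrArg g (mem_cluster.mp hp).2, Finset.sum_const,
    nsmul_eq_mul]

theorem sum_mul_comp_assignment (P : Finset (Pt d)) (σ : Pt d → Fin k) (f : Pt d → ℝ)
    (g : Fin k → ℝ) : ∑ p ∈ P, f p * g (σ p) = ∑ j, (∑ p ∈ cluster P σ j, f p) * g j := by
  rw [← sum_sum_cluster P σ]
  refine Finset.sum_congr rfl fun j _ => ?_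
  rw [Finset.sum_mul]
  exact Finset.sum_congr rfl fun p hp => by rw [(mem_cluster.mp hp).2]

theorem mul_div_le_of_nonneg {a : ℝ} (b : ℝ) (ha : 0 ≤ a) : b * (a / b) ≤ a := by
  rw [mul_div_left_comm]
  exact mul_le_of_le_one_right ha (div_self_le_one b)

theorem sum_mul_one_div_mul_le_one (s : Fin k → ℝ) : ∑ j, s j * (1 / (k * s j)) ≤ 1 := by
  calc ∑ j, s j * (1 / (k * s j)) ≤ ∑ _j : Fin k, 1 / (k : ℝ) :=
        Finset.sum_le_sum fun j _ => by
          rw [← div_div]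
          exact mul_div_le_of_nonneg _ (by positivity)
    _ = k * (1 / k) := by simp
    _ ≤ 1 := mul_div_le_of_nonneg _ zero_le_one

theorem avgCost_nonneg (p : Pt d) : 0 ≤ avgCost P A σ p :=
  div_nonneg (cost_nonneg _ _) (Nat.cast_nonneg _)

theorem sum_avgCost_le : ∑ p ∈ P, avgCost P A σ p ≤ cost P A := by
  calc ∑ p ∈ P, avgCost P A σ p
      = ∑ j, (cluster P σ j).card * (cost (cluster P σ j) A / (cluster P σ j).card) :=
        sum_comp_assignment P σ fun j => cost (cluster P σ j) A / (cluster P σ j).card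
    _ ≤ ∑ j, cost (cluster P σ j) A :=
        Finset.sum_le_sum fun j _ => mul_div_le_of_nonneg _ (cost_nonneg _ _)
    _ = cost P A := sum_sum_cluster P σ fun p => ptCost p A

theorem sum_score_le_one : ∑ p ∈ P, score P A σ p ≤ 1 := by
  have hsize : ∑ p ∈ P, 1 / ((k : ℝ) * (cluster P σ (σ p)).card) ≤ 1 :=
    (sum_comp_assignment P σ fun j => 1 / ((k : ℝ) * (cluster P σ j).card)).trans_le
      (sum_mul_one_div_mul_le_one _)
  have hclusterCost : ∑ p ∈ P, ptCost p A / ((k : ℝ) * cost (cluster P σ (σ p)) A) ≤ 1 := by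
    simp only [div_eq_mul_one_div (ptCost _ A)]
    exact (sum_mul_comp_assignment P σ (fun p => ptCost p A)
      fun j => 1 / ((k : ℝ) * cost (cluster P σ j) A)).trans_le (sum_mul_one_div_mul_le_one _)
  have hcost : ∑ p ∈ P, ptCost p A / cost P A ≤ 1 := by
    rw [← Finset.sum_div]
    exact div_self_le_one _
  have havgCost : ∑ p ∈ P, avgCost P A σ p / cost P A ≤ 1 := by
    rw [← Finset.sum_div]
    exact div_le_one_of_le₀ sum_avgCost_le (cost_nonneg P A)
  simp only [score, ← Finset.mul_sum, Finset.sum_add_distrib]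
  linarith

theorem mu_pos (hp : p ∈ P) : 0 < mu P A σ p :=
  div_pos (score_pos P A σ p hp) (Finset.sum_pos (score_pos P A σ) ⟨p, hp⟩)

theorem score_le_mu (hp : p ∈ P) : score P A σ p ≤ mu P A σ p := by
  rw [mu, le_div_iff₀ (Finset.sum_pos (score_pos P A σ) ⟨p, hp⟩)]
  exact mul_le_of_le_one_right (score_pos P A σ p hp).le sum_score_le_one

theorem one_div_card_cluster_le (hp : p ∈ P) :
    1 / (cluster P σ (σ p)).card ≤ 4 * k * mu P A σ p := by
  have hk : (0 : ℝ) < k := by exact_mod_cast (σ p).pos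
  have hclusterCost : 0 ≤ ptCost p A / ((k : ℝ) * cost (cluster P σ (σ p)) A) :=
    div_nonneg (ptCost_nonneg p A) (mul_nonneg hk.le (cost_nonneg _ A))
  have hcost : 0 ≤ ptCost p A / cost P A := div_nonneg (ptCost_nonneg p A) (cost_nonneg P A)
  have havgCost : 0 ≤ avgCost P A σ p / cost P A :=
    div_nonneg (avgCost_nonneg p) (cost_nonneg P A)
  have hscore : 1 / ((k : ℝ) * (cluster P σ (σ p)).card) ≤ 4 * mu P A σ p := by
    have h := score_le_mu (A := A) (σ := σ) hp
    unfold score at h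
    linarith
  rw [mul_comm (k : ℝ), ← div_div, div_le_iff₀ hk] at hscore
  linarith

theorem ptCost_le_mul_mu (hp : p ∈ P) : ptCost p A ≤ 4 * cost P A * mu P A σ p := by
  rcases (cost_nonneg P A).eq_or_lt with h0 | hpos
  · have hle : ptCost p A ≤ cost P A :=
      Finset.single_le_sum (f := fun p => ptCost p A) (fun x _ => ptCost_nonneg x A) hp
    rw [← h0] at hle ⊢
    linarith
  · have hsize : 0 ≤ 1 / ((k : ℝ) * (cluster P σ (σ p)).card) := by positivity
    have hclusterCost : 0 ≤ ptCost p A / ((k : ℝ) * cost (cluster P σ (σ p)) A) :=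
      div_nonneg (ptCost_nonneg p A) (mul_nonneg k.cast_nonneg (cost_nonneg _ A))
    have havgCost : 0 ≤ avgCost P A σ p / cost P A := div_nonneg (avgCost_nonneg p) hpos.le
    have hscore : ptCost p A / cost P A ≤ 4 * mu P A σ p := by
      have h := score_le_mu (A := A) (σ := σ) hp
      unfold score at h
      linarith
    rw [div_le_iff₀ hpos] at hscore
    linarith

end Scores

section SamplingError

variable {d k m : ℕ} {P : Finset (Pt d)} {A : Fin k → Pt d} {σ : Pt d → Fin k}

instance (hP : P.Nonempty) : IsProbabilityMeasure (sampleLaw P hP A σ m) := by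
  unfold sampleLaw
  infer_instance

theorem integral_samplingPMF (hP : P.Nonempty) (g : {x // x ∈ P} → ℝ) :
    ∫ p, g p ∂(samplingPMF P hP A σ).toMeasure = ∑ p : {x // x ∈ P}, mu P A σ p * g p := by
  rw [PMF.integral_eq_sum]
  refine Finset.sum_congr rfl fun p _ => ?_
  rw [samplingPMF, PMF.ofFintype_apply, ENNReal.toReal_ofReal (mu_pos p.2).le, smul_eq_mul]

theorem integral_div_mu (hP : P.Nonempty) (g : Pt d → ℝ) :
    ∫ p, g p / mu P A σ p ∂(samplingPMF P hP A σ).toMeasure = ∑ p ∈ P, g p := by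
  rw [integral_samplingPMF, ← Finset.sum_coe_sort P g]
  exact Finset.sum_congr rfl fun p _ => mul_div_cancel₀ _ (mu_pos p.2).ne'

/-- The error of the importance sampling estimate of `m * ∑ p ∈ P, g p` from the samples `q`. -/
noncomputable def samplingError (A : Fin k → Pt d) (σ : Pt d → Fin k) (q : Fin m → {x // x ∈ P})
    (g : Pt d → ℝ) : ℝ :=
  ∑ i, g (q i) / mu P A σ (q i) - m * ∑ p ∈ P, g p

theorem samplingError_eq_sum_sub_integral (hP : P.Nonempty) (q : Fin m → {x // x ∈ P})
    (g : Pt d → ℝ) :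
    samplingError A σ q g = ∑ i, g (q i) / mu P A σ (q i) -
      Fintype.card (Fin m) * ∫ p, g p / mu P A σ p ∂(samplingPMF P hP A σ).toMeasure := by
  rw [samplingError, integral_div_mu, Fintype.card_fin]

theorem samplingError_add (q : Fin m → {x // x ∈ P}) (g g' : Pt d → ℝ) :
    samplingError A σ q (fun p => g p + g' p) =
      samplingError A σ q g + samplingError A σ q g' := by
  simp only [samplingError, add_div, Finset.sum_add_distrib]
  ring

theorem samplingError_sum_mul {ι : Type*} (s : Finset ι) (q : Fin m → {x // x ∈ P}) (c : ι → ℝ)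
    (g : ι → Pt d → ℝ) :
    samplingError A σ q (fun p => ∑ t ∈ s, c t * g t p) =
      ∑ t ∈ s, c t * samplingError A σ q (g t) := by
  simp only [samplingError, mul_sub, Finset.sum_sub_distrib, Finset.mul_sum, Finset.sum_div,
    mul_div_assoc, mul_left_comm (c _) (m : ℝ)]
  rw [Finset.sum_comm]
  congr 1
  exact Finset.sum_comm

theorem samplingError_congr (q : Fin m → {x // x ∈ P}) {g g' : Pt d → ℝ}
    (h : ∀ p ∈ P, g p = g' p) : samplingError A σ q g = samplingError A σ q g' := by
  simp only [samplingError, h _ (q _).2, Finset.sum_congr rfl h]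

theorem samplingError_ptCost (hm : 0 < m) (q : Fin m → {x // x ∈ P}) (S : Fin k → Pt d) :
    samplingError A σ q (fun p => ptCost p S) =
      m * (∑ i, sampleWeight P A σ m (q i) * ptCost (q i : Pt d) S - cost P S) := by
  have hmR : (m : ℝ) ≠ 0 := by exact_mod_cast hm.ne'
  rw [samplingError, mul_sub]
  congr 1
  rw [Finset.mul_sum]
  refine Finset.sum_congr rfl fun i _ => ?_
  have := (mu_pos (A := A) (σ := σ) (q i).2).ne'
  rw [sampleWeight]
  field_simp

theorem integral_ciSup_abs_samplingError_relCost_le (hP : P.Nonempty) (hσ : IsNearest P A σ)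
    (hA : 0 < cost P A) (hkm : k ≤ m) (x : ℕ) {ι : Type*} [Finite ι] [Nonempty ι]
    (S : ι → Fin k → Pt d) (hS : ∀ t, (ambiguous A (S t)).card ≤ x) (H : ℕ) :
    ∫ q, ⨆ t, |samplingError A σ q (fun p => relCost (A (σ p)) p (S t))|
        ∂(sampleLaw P hP A σ m) ≤
      2 * chainingBound (4 * cost P A) k m x H := by
  have : NeZero k := ⟨(σ hP.choose).pos.ne'⟩
  let f (t : ι) (p : {x // x ∈ P}) : ℝ := relCost (A (σ p)) p (S t) / mu P A σ p
  have hpointwise (q : Fin m → {x // x ∈ P}) : rademacherAvg (fun t i => f t (q i)) ≤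
      chainingBound (4 * cost P A) k m x H := by
    simp only [f, div_eq_inv_mul (relCost _ _ _)]
    refine rademacherAvg_relCost_le hkm (fun i => (q i : Pt d)) A (fun i => σ (q i))
      (by positivity) (fun i => inv_nonneg.mpr (mu_pos (q i).2).le) (fun i => ?_) x hS H
    rw [← ptCost_eq_of_isNearest hσ (q i).2, inv_mul_le_iff₀ (mu_pos (q i).2), mul_comm]
    exact ptCost_le_mul_mu (q i).2
  simp only [samplingError_eq_sum_sub_integral hP]
  refine (integral_ciSup_abs_sum_sub_mean_le_rademacherAvg (f := f) fun _ => .of_finite).trans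
    (mul_le_mul_of_nonneg_left ?_ zero_le_two)
  have h := integral_mono (μ := sampleLaw P hP A σ m)
    (integrable_rademacherAvg (f := f) fun _ => .of_finite) (integrable_const _) hpointwise
  rwa [integral_const, probReal_univ, one_smul] at h

/-- The density, with respect to the counting measure, of the uniform distribution on the cluster
`C_j`. Estimating its sum over `P` by sampling amounts to estimating the size of `C_j` up to a
relative error. It is `0` if `C_j` is empty. -/
noncomputable def clusterDensity (P : Finset (Pt d)) (σ : Pt d → Fin k) (j : Fin k) (p : Pt d) :
    ℝ :=
  if σ p = j then 1 / ((cluster P σ j).card : ℝ) else 0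

theorem sum_clusterDensity_le_one (j : Fin k) : ∑ p ∈ P, clusterDensity P σ j p ≤ 1 := by
  simp only [clusterDensity, ← Finset.sum_filter, Finset.sum_const, nsmul_eq_mul]
  exact mul_div_le_of_nonneg _ zero_le_one

theorem clusterDensity_div_mu_mem_Icc (j : Fin k) (p : {x // x ∈ P}) :
    clusterDensity P σ j p / mu P A σ p ∈ Set.Icc (0 : ℝ) (4 * k) := by
  have hmu := mu_pos (A := A) (σ := σ) p.2
  unfold clusterDensity
  split_ifs with hj
  · subst hj
    exact ⟨by positivity, (div_le_iff₀ hmu).mpr (one_div_card_cluster_le p.2)⟩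
  · simp

theorem integral_ciSup_abs_samplingError_clusterDensity_le (hP : P.Nonempty) {θ : ℝ} (hθ : 0 < θ)
    (hθ1 : θ ≤ 1) (hθm : 32 * k * Real.log (2 * k) ≤ θ ^ 2 * m) :
    ∫ q, ⨆ j, |samplingError A σ q (clusterDensity P σ j)| ∂(sampleLaw P hP A σ m) ≤
      2 * θ * m := by
  have hk : 0 < k := (σ hP.choose).pos
  have : NeZero k := ⟨hk.ne'⟩
  simp only [samplingError_eq_sum_sub_integral hP]
  refine (integral_ciSup_abs_sum_sub_mean_le_of_mem_Icc (B := 4 * k) (by positivity) hθ hθ1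
    (fun _ => .of_finite) clusterDensity_div_mu_mem_Icc
    (fun j => (integral_div_mu hP _).trans_le (sum_clusterDensity_le_one j)) ?_).trans_eq ?_
  · rw [Nat.card_fin, Fintype.card_fin]
    linarith
  · rw [Fintype.card_fin]

end SamplingError

section Events

theorem mul_measureReal_le_integral_of_le_on {Ω : Type*} [MeasurableSpace Ω] {μ : Measure Ω}
    [IsFiniteMeasure μ] {B : Set Ω} {F : Ω → ℝ} {τ : ℝ} (hF : Integrable F μ) (hF0 : ∀ ω, 0 ≤ F ω)
    (hτ : 0 ≤ τ) (hB : ∀ ω ∈ B, τ ≤ F ω) : τ * μ.real B ≤ ∫ ω, F ω ∂μ :=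
  (mul_le_mul_of_nonneg_left (measureReal_mono hB) hτ).trans
    (mul_meas_ge_le_integral_of_nonneg (ae_of_all _ hF0) hF τ)

variable {d k m : ℕ} {P : Finset (Pt d)} {A : Fin k → Pt d} {σ : Pt d → Fin k}

/-- The samples that misestimate the size of some cluster by more than a factor `1 ± η`. -/
def badSizes (P : Finset (Pt d)) (A : Fin k → Pt d) (σ : Pt d → Fin k) (m : ℕ) (η : ℝ) :
    Set (Fin m → {x // x ∈ P}) :=
  {q | ∃ j, η * m < |samplingError A σ q (clusterDensity P σ j)|}

/-- The samples that misestimate the total relative cost of some solution `S ∈ 𝒞` by more than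
`ε / 2 * cost P S`. Half of the allowed error is left for the cluster sizes. -/
def badCosts (P : Finset (Pt d)) (A : Fin k → Pt d) (σ : Pt d → Fin k) (m : ℕ) (ε : ℝ)
    (𝒞 : Set (Fin k → Pt d)) : Set (Fin m → {x // x ∈ P}) :=
  {q | ∃ S ∈ 𝒞, m * (ε / 2) * cost P S < |samplingError A σ q fun p => relCost (A (σ p)) p S|}

theorem measureReal_badSizes_le (hP : P.Nonempty) (hm : 0 < m) {η : ℝ} (hη : 0 < η) (hη1 : η ≤ 1)
    (hηm : 32 * k * Real.log (2 * k) ≤ (η / 12) ^ 2 * m) :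
    (sampleLaw P hP A σ m).real (badSizes P A σ m η) ≤ 1 / 6 := by
  have : (0 : ℝ) < m := by exact_mod_cast hm
  have hexpect := integral_ciSup_abs_samplingError_clusterDensity_le (A := A) (σ := σ) hP
    (θ := η / 12) (by positivity) (by linarith) hηm
  have hmarkov := mul_measureReal_le_integral_of_le_on (μ := sampleLaw P hP A σ m)
    (B := badSizes P A σ m η) (τ := η * m)
    (F := fun q => ⨆ j, |samplingError A σ q (clusterDensity P σ j)|) .of_finite
    (fun _ => Real.iSup_nonneg fun _ => abs_nonneg _) (by positivity)
    fun q ⟨j, hj⟩ => hj.le.trans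
      (Finite.le_ciSup (fun j => |samplingError A σ q (clusterDensity P σ j)|) j)
  refine le_of_mul_le_mul_left ?_ (show 0 < η * m by positivity)
  linarith

theorem mul_measureReal_badCosts_le (hP : P.Nonempty) (hσ : IsNearest P A σ) (hA : 0 < cost P A)
    (hkm : k ≤ m) (x : ℕ) {ε K : ℝ} (hε : 0 < ε) (hK : 0 ≤ K) {𝒞 : Set (Fin k → Pt d)}
    (hx : ∀ S ∈ 𝒞, (ambiguous A S).card ≤ x) (hcost : ∀ S ∈ 𝒞, K ≤ cost P S) (H : ℕ) :
    m * (ε / 2) * K * (sampleLaw P hP A σ m).real (badCosts P A σ m ε 𝒞) ≤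
      2 * chainingBound (4 * cost P A) k m x H := by
  rcases isEmpty_or_nonempty (badCosts P A σ m ε 𝒞) with hempty | hne
  · rw [Set.isEmpty_coe_sort.mp hempty, measureReal_empty, mul_zero]
    exact mul_nonneg zero_le_two (chainingBound_nonneg (by positivity) _ _ _ _)
  -- There are finitely many samples, hence one violating solution for each bad sample suffices.
  choose S hS hbad using fun q : badCosts P A σ m ε 𝒞 => q.2
  refine le_trans ?_ (integral_ciSup_abs_samplingError_relCost_le hP hσ hA hkm x S
    (fun q => hx _ (hS q)) H)
  refine mul_measureReal_le_integral_of_le_on .of_finite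
    (fun _ => Real.iSup_nonneg fun _ => abs_nonneg _) (by positivity) fun q hq => ?_
  calc m * (ε / 2) * K ≤ m * (ε / 2) * cost P (S ⟨q, hq⟩) :=
        mul_le_mul_of_nonneg_left (hcost _ (hS _)) (by positivity)
    _ ≤ |samplingError A σ q fun p => relCost (A (σ p)) p (S ⟨q, hq⟩)| := (hbad ⟨q, hq⟩).le
    _ ≤ ⨆ t, |samplingError A σ q fun p => relCost (A (σ p)) p (S t)| :=
        Finite.le_ciSup (fun t => |samplingError A σ q fun p => relCost (A (σ p)) p (S t)|) _

theorem sum_ptCost_center_le (hσ : IsNearest P A σ) (S : Fin k → Pt d) :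
    ∑ p ∈ P, ptCost (A (σ p)) S ≤ cost P A + cost P S := by
  unfold cost
  rw [← Finset.sum_add_distrib]
  refine Finset.sum_le_sum fun p hp => ?_
  have : NeZero k := ⟨(σ p).pos.ne'⟩
  rw [ptCost_eq_of_isNearest hσ hp, dist_comm]
  exact ptCost_le_dist_add_ptCost _ _ _

theorem ptCost_center_eq_sum_clusterDensity (S : Fin k → Pt d) {p : Pt d} (hp : p ∈ P) :
    ptCost (A (σ p)) S =
      ∑ j, (cluster P σ j).card * ptCost (A j) S * clusterDensity P σ j p := by
  have hcard : ((cluster P σ (σ p)).card : ℝ) ≠ 0 := by exact_mod_cast (card_cluster_pos hp).ne'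
  simp only [clusterDensity, mul_ite, mul_zero, Finset.sum_ite_eq, Finset.mem_univ, if_true]
  field_simp

theorem abs_samplingError_ptCost_center_le {q : Fin m → {x // x ∈ P}} {η : ℝ}
    (h : q ∉ badSizes P A σ m η) (S : Fin k → Pt d) :
    |samplingError A σ q fun p => ptCost (A (σ p)) S| ≤
      η * m * ∑ p ∈ P, ptCost (A (σ p)) S := by
  have hsize (j : Fin k) : |samplingError A σ q (clusterDensity P σ j)| ≤ η * m :=
    not_lt.mp fun hj => h ⟨j, hj⟩
  rw [samplingError_congr q fun p hp => ptCost_center_eq_sum_clusterDensity S hp,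
    samplingError_sum_mul]
  calc |∑ j, (cluster P σ j).card * ptCost (A j) S * samplingError A σ q (clusterDensity P σ j)|
      ≤ ∑ j, |(cluster P σ j).card * ptCost (A j) S *
          samplingError A σ q (clusterDensity P σ j)| := Finset.abs_sum_le_sum_abs _ _
    _ ≤ ∑ j, (cluster P σ j).card * ptCost (A j) S * (η * m) := by
        refine Finset.sum_le_sum fun j _ => ?_
        have hnonneg : 0 ≤ (cluster P σ j).card * ptCost (A j) S :=
          mul_nonneg (Nat.cast_nonneg _) (ptCost_nonneg _ _)
        rw [abs_mul, abs_of_nonneg hnonneg]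
        exact mul_le_mul_of_nonneg_left (hsize j) hnonneg
    _ = η * m * ∑ p ∈ P, ptCost (A (σ p)) S := by
        rw [sum_comp_assignment P σ fun j => ptCost (A j) S, ← Finset.sum_mul, mul_comm]

theorem isCoreset_of_notMem (hσ : IsNearest P A σ) (hm : 0 < m) {ε γ : ℝ} (hε : 0 ≤ ε)
    (hγ : 0 ≤ γ) (hA : IsApprox γ P A) {q : Fin m → {x // x ∈ P}}
    (hsizes : q ∉ badSizes P A σ m (ε / (2 * (1 + γ)))) (hcosts : q ∉ badCosts P A σ m ε Set.univ) :
    IsCoreset P k ε (fun i => (q i : Pt d)) (fun i => sampleWeight P A σ m (q i)) := by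
  intro S
  have hmR : (0 : ℝ) < m := by exact_mod_cast hm
  have hrel : |samplingError A σ q fun p => relCost (A (σ p)) p S| ≤ m * (ε / 2) * cost P S :=
    not_lt.mp fun h => hcosts ⟨S, Set.mem_univ _, h⟩
  have hcenter : |samplingError A σ q fun p => ptCost (A (σ p)) S| ≤ m * (ε / 2) * cost P S := by
    have hcostA : cost P A ≤ γ * cost P S :=
      hA.trans (mul_le_mul_of_nonneg_left (opt_le_cost P S) hγ)
    calc |samplingError A σ q fun p => ptCost (A (σ p)) S|
        ≤ ε / (2 * (1 + γ)) * m * ∑ p ∈ P, ptCost (A (σ p)) S :=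
          abs_samplingError_ptCost_center_le hsizes S
      _ ≤ ε / (2 * (1 + γ)) * m * ((1 + γ) * cost P S) := by
          refine mul_le_mul_of_nonneg_left ?_ (by positivity)
          linarith [sum_ptCost_center_le hσ S]
      _ = m * (ε / 2) * cost P S := by field_simp
  have hdecompose : samplingError A σ q (fun p => ptCost p S) =
      samplingError A σ q (fun p => relCost (A (σ p)) p S) +
        samplingError A σ q (fun p => ptCost (A (σ p)) S) := by
    rw [← samplingError_add]
    simp only [relCost, sub_add_cancel]
  have htotal : m * |∑ i, sampleWeight P A σ m (q i) * ptCost (q i : Pt d) S - cost P S| ≤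
      m * (ε * cost P S) := by
    rw [← abs_of_pos hmR, ← abs_mul, abs_of_pos hmR, ← samplingError_ptCost hm, hdecompose]
    linarith [abs_add_le (samplingError A σ q fun p => relCost (A (σ p)) p S)
      (samplingError A σ q fun p => ptCost (A (σ p)) S)]
  have h := abs_le.mp (le_of_mul_le_mul_left htotal hmR)
  constructor <;> linarith

end Events

section Arithmetic

theorem log_le_two_mul_sqrt {y : ℝ} (hy : 0 ≤ y) : Real.log y ≤ 2 * √y := by
  have h := Real.log_le_rpow_div hy one_half_pos
  rw [← Real.sqrt_eq_rpow] at h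
  linarith

theorem mul_log_add_le {W m B c : ℝ} (hW : 0 < W) (hWB : Real.log W ≤ B) (hBc : 0 ≤ B + c)
    (hm : W * (16 + 2 * (B + c)) ≤ m) : W * (Real.log m + c) ≤ m := by
  obtain ⟨y, rfl⟩ : ∃ y, m = W * y := ⟨m / W, (mul_div_cancel₀ m hW.ne').symm⟩
  have hy : 16 + 2 * (B + c) ≤ y := le_of_mul_le_mul_left hm hW
  have hsqrt : 4 ≤ √y := Real.le_sqrt_of_sq_le (by linarith)
  have hlog : Real.log y ≤ y / 2 := by
    nlinarith [log_le_two_mul_sqrt (show 0 ≤ y by linarith),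
      Real.mul_self_sqrt (show 0 ≤ y by linarith)]
  rw [Real.log_mul hW.ne' (by linarith)]
  exact mul_le_mul_of_nonneg_left (by linarith) hW.le

theorem exists_le_two_pow {z : ℝ} (hz : 1 ≤ z) :
    ∃ H : ℕ, z ≤ 2 ^ H ∧ (H : ℝ) ≤ 2 * Real.log z + 1 := by
  have hlog : 0 ≤ Real.log z := Real.log_nonneg hz
  refine ⟨⌈2 * Real.log z⌉₊, ?_, (Nat.ceil_lt_add_one (by linarith)).le⟩
  rw [← Real.log_le_log_iff (by linarith) (by positivity), Real.log_pow]
  nlinarith [Nat.le_ceil (2 * Real.log z), Real.log_two_gt_d9]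

theorem natLog_add_one_le {k : ℕ} (hk : 1 ≤ k) :
    ((Nat.log 2 (k + 1) + 1 : ℕ) : ℝ) ≤ 2 * (1 + Real.log k) := by
  have hkR : (1 : ℝ) ≤ k := by exact_mod_cast hk
  have hlogk : 0 ≤ Real.log k := Real.log_nonneg hkR
  have hlog : Real.log (k + 1) ≤ Real.log 2 + Real.log k := by
    rw [← Real.log_mul two_ne_zero (by positivity)]
    exact Real.log_le_log (by positivity) (by linarith)
  have hlogb : Real.logb 2 (k + 1) ≤ 1 + 2 * Real.log k := by
    rw [Real.logb, div_le_iff₀ (Real.log_pos one_lt_two)]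
    nlinarith [Real.log_two_gt_d9]
  have h := Real.natLog_le_logb (k + 1) 2
  push_cast at h ⊢
  linarith

theorem log_three_thousand_le : Real.log 3000 ≤ 9 := by
  have h : Real.log 3000 ≤ Real.log (2 ^ 12) := Real.log_le_log (by norm_num) (by norm_num)
  rw [Real.log_pow] at h
  push_cast at h
  linarith [Real.log_two_lt_d9]

theorem log_two_mul_le {k : ℝ} (hk : 0 < k) : Real.log (2 * k) ≤ 1 + Real.log k := by
  rw [Real.log_mul two_ne_zero hk.ne']
  linarith [Real.log_two_lt_d9]

/-- The factor over `OPT` that `2 ^ l - 1` ambiguous clusters force upon the cost of a solution. -/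
noncomputable def growthFactor (β D : ℝ) (l : ℕ) : ℝ :=
  max 1 ((2 ^ l - 1) * (β / D))

theorem one_le_growthFactor (β D : ℝ) (l : ℕ) : 1 ≤ growthFactor β D l :=
  le_max_left _ _

theorem two_pow_le_mul_growthFactor_sq {β D : ℝ} (hβ : 0 < β) (hD : 1 ≤ D) (l : ℕ) :
    (2 : ℝ) ^ l ≤ 2 * D * max 1 (1 / β) * growthFactor β D l ^ 2 := by
  set M := growthFactor β D l
  have hM : 1 ≤ M := one_le_growthFactor β D l
  have hv : 1 ≤ max 1 (1 / β) := le_max_left _ _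
  rcases Nat.eq_zero_or_pos l with rfl | hl
  · rw [pow_zero]
    exact one_le_mul_of_one_le_of_one_le
      (one_le_mul_of_one_le_of_one_le (by linarith) hv) (one_le_pow₀ hM)
  · have htwo : (2 : ℝ) ≤ 2 ^ l := le_self_pow₀ one_le_two hl.ne'
    calc (2 : ℝ) ^ l ≤ 2 * (2 ^ l - 1) := by linarith
      _ = 2 * D * (1 / β) * ((2 ^ l - 1) * (β / D)) := by field_simp
      _ ≤ 2 * D * max 1 (1 / β) * M := by
          gcongr
          · exact mul_nonneg (by linarith) (by positivity)
          · exact le_max_right _ _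
          · exact le_max_right _ _
      _ ≤ 2 * D * max 1 (1 / β) * M ^ 2 := by
          gcongr
          exact le_self_pow₀ hM two_ne_zero

section Scale

variable {k ε : ℝ} (hk : 1 ≤ k) (hε : 0 < ε) (hε1 : ε < 1)
include hk hε hε1

theorem log_le_log_div : Real.log k ≤ Real.log (k / ε) := by
  rw [Real.log_div (by positivity) hε.ne']
  linarith [Real.log_nonpos hε.le hε1.le]

theorem one_le_one_add_log_div : 1 ≤ 1 + Real.log (k / ε) := by
  linarith [Real.log_nonneg hk, log_le_log_div hk hε hε1]

theorem exists_chaining_depth {g : ℝ} (hg : 1 ≤ g) :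
    ∃ H : ℕ, g * (1 + Real.log (k / ε)) / ε ≤ 2 ^ H ∧
      (H : ℝ) ≤ (2 * Real.log g + 5) * (1 + Real.log (k / ε)) := by
  have hL := one_le_one_add_log_div hk hε hε1
  have hεL : -Real.log ε ≤ Real.log (k / ε) := by
    rw [Real.log_div (by positivity) hε.ne']
    linarith [Real.log_nonneg hk]
  set L := 1 + Real.log (k / ε)
  have hz : 1 ≤ g * L / ε := by
    rw [le_div_iff₀ hε]
    nlinarith
  obtain ⟨H, hzH, hH⟩ := exists_le_two_pow hz
  refine ⟨H, hzH, hH.trans ?_⟩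
  rw [Real.log_div (by positivity) hε.ne', Real.log_mul (by positivity) (by positivity)]
  have hlogL : Real.log L ≤ L - 1 := Real.log_le_sub_one_of_pos (by linarith)
  have hlogg : Real.log g ≤ Real.log g * L := le_mul_of_one_le_right (Real.log_nonneg hg) hL
  linarith

theorem log_width_le {c v : ℝ} (hc : 1 ≤ c) (hv : 1 ≤ v) (hvk : v ≤ 2 * k) :
    Real.log (c * (k / ε ^ 2) * v * (1 + Real.log (k / ε)) ^ 4) ≤
      (Real.log c + 9) * (1 + Real.log (k / ε)) := by
  have hL := one_le_one_add_log_div hk hε hε1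
  have hlogk := log_le_log_div hk hε hε1
  have hlogkε : Real.log (k / ε ^ 2) ≤ 2 * Real.log (k / ε) := by
    rw [Real.log_div (by positivity) (by positivity), Real.log_div (by positivity) hε.ne',
      Real.log_pow]
    push_cast
    linarith [Real.log_nonneg hk]
  set L := 1 + Real.log (k / ε)
  have hlogv : Real.log v ≤ 1 + Real.log k :=
    (Real.log_le_log (by linarith) hvk).trans (log_two_mul_le (by linarith))
  have hlogL : Real.log L ≤ L - 1 := Real.log_le_sub_one_of_pos (by linarith)
  have hlogc : Real.log c ≤ Real.log c * L := le_mul_of_one_le_right (Real.log_nonneg hc) hL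
  rw [Real.log_mul (by positivity) (by positivity), Real.log_mul (by positivity) (by positivity),
    Real.log_mul (by positivity) (by positivity), Real.log_pow]
  push_cast
  linarith

theorem width_mul_log_add_le {a c v m : ℝ} (ha : 0 ≤ a) (hc : 1 ≤ c) (hv : 1 ≤ v)
    (hvk : v ≤ 2 * k)
    (hm : c * (k / ε ^ 2) * v * (1 + Real.log (k / ε)) ^ 4 *
      ((16 + 2 * (Real.log c + 9 + a)) * (1 + Real.log (k / ε))) ≤ m) :
    c * (k / ε ^ 2) * v * (1 + Real.log (k / ε)) ^ 4 *
      (Real.log m + a * (1 + Real.log (k / ε))) ≤ m := by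
  have hL := one_le_one_add_log_div hk hε hε1
  have hwidth := log_width_le hk hε hε1 hc hv hvk
  have hlogc := Real.log_nonneg hc
  set L := 1 + Real.log (k / ε)
  refine mul_log_add_le (by positivity) hwidth (by positivity) (le_trans ?_ hm)
  refine mul_le_mul_of_nonneg_left ?_ (by positivity)
  linarith

end Scale

theorem log_three_thousand_mul_add_le {L b m H : ℝ} (hL : 1 ≤ L) (hm : 0 < m) (hH : H ≤ b * L) :
    Real.log (3000 * m) + 2 * H ≤ Real.log m + (9 + 2 * b) * L := by
  rw [Real.log_mul (by norm_num) hm.ne']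
  linarith [log_three_thousand_le]

theorem cluster_size_condition {γ ε k L m c : ℝ} (hγ : 1 ≤ γ) (hε : 0 < ε) (hk : 0 < k)
    (hkL : 1 + Real.log k ≤ L) (hL : 0 ≤ L) (hc : 73728 * γ ^ 2 ≤ c)
    (hm : c * (k / ε ^ 2) * L ≤ m) :
    32 * k * Real.log (2 * k) ≤ (ε / (2 * (1 + γ)) / 12) ^ 2 * m := by
  have hlog : Real.log (2 * k) ≤ L := (log_two_mul_le hk).trans hkL
  have hγ4 : (1 + γ) ^ 2 ≤ 4 * γ ^ 2 := by nlinarith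
  have hscale : (ε / (2 * (1 + γ)) / 12) ^ 2 * m = ε ^ 2 * m / (24 * (1 + γ)) ^ 2 := by
    field_simp
    ring
  rw [hscale, le_div_iff₀ (by positivity)]
  calc 32 * k * Real.log (2 * k) * (24 * (1 + γ)) ^ 2
      ≤ 32 * k * L * (24 * (1 + γ)) ^ 2 := by gcongr
    _ = 18432 * (1 + γ) ^ 2 * (k * L) := by ring
    _ ≤ 18432 * (4 * γ ^ 2) * (k * L) := by gcongr
    _ = 73728 * γ ^ 2 * (k * L) := by ring
    _ ≤ c * (k * L) := by gcongr
    _ = ε ^ 2 * (c * (k / ε ^ 2) * L) := by field_simp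
    _ ≤ ε ^ 2 * m := by gcongr

theorem two_mul_chainingBound_le {γ ε L M b : ℝ} {k m x H : ℕ} (hγ : 0 < γ) (hε : 0 < ε)
    (hL : 0 < L) (hM : 1 ≤ M) (hb : 0 < b) (hHb : (H : ℝ) ≤ b * L)
    (hH : 13056 * γ * L / ε ≤ 2 ^ H)
    (hwidth : (104448 * γ * b * L ^ 2) ^ 2 *
      (132 * k * (1 + x) * (Real.log (3000 * m) + 2 * H)) ≤ m * (ε * M) ^ 2) :
    2 * chainingBound (4 * γ) k m x H ≤ m * (ε / 2) * M / (12 * L) := by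
  unfold chainingBound
  set Λ := 132 * k * (1 + x) * (Real.log (3000 * m) + 2 * H)
  have hsqrt : √(m * Λ) ≤ m * (ε * M) / (104448 * γ * b * L ^ 2) := by
    refine Real.sqrt_le_iff.mpr ⟨by positivity, ?_⟩
    rw [div_pow, le_div_iff₀ (by positivity)]
    calc m * Λ * (104448 * γ * b * L ^ 2) ^ 2 = m * ((104448 * γ * b * L ^ 2) ^ 2 * Λ) := by ring
      _ ≤ m * (m * (ε * M) ^ 2) := by gcongr
      _ = (m * (ε * M)) ^ 2 := by ring
  have hchain : 8 * H * (34 * (4 * γ)) * √(m * Λ) ≤ m * ε * M / (96 * L) := by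
    calc 8 * H * (34 * (4 * γ)) * √(m * Λ)
        ≤ 8 * (b * L) * (34 * (4 * γ)) * (m * (ε * M) / (104448 * γ * b * L ^ 2)) := by gcongr
      _ = m * ε * M / (96 * L) := by
          field_simp
          ring
  have htail : 34 * (4 * γ) * m / 2 ^ H ≤ m * ε * M / (96 * L) := by
    calc 34 * (4 * γ) * m / 2 ^ H ≤ 34 * (4 * γ) * m / (13056 * γ * L / ε) := by gcongr
      _ = m * ε * 1 / (96 * L) := by
          field_simp
          ring
      _ ≤ m * ε * M / (96 * L) := by gcongr
  calc 2 * (8 * H * (34 * (4 * γ)) * √(m * Λ) + 34 * (4 * γ) * m / 2 ^ H)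
      ≤ 2 * (m * ε * M / (96 * L) + m * ε * M / (96 * L)) := by linarith
    _ = m * (ε / 2) * M / (12 * L) := by
        field_simp
        ring

theorem two_mul_chainingBound_two_pow_le {γ ε L M b v : ℝ} {k m H l : ℕ} (hγ : 0 < γ)
    (hε : 0 < ε) (hL : 1 ≤ L) (hM : 1 ≤ M) (hb : 0 < b) (hv : 0 ≤ v) (hm : 0 < m)
    (hHb : (H : ℝ) ≤ b * L) (hH : 13056 * γ * L / ε ≤ 2 ^ H) (hl : (2 : ℝ) ^ l ≤ v * M ^ 2)
    (hwidth : 396 * (104448 * γ * b) ^ 2 * (k / ε ^ 2) * v * L ^ 4 *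
      (Real.log m + (9 + 2 * b) * L) ≤ m) :
    2 * chainingBound (4 * γ) k m (2 ^ (l + 1)) H ≤ m * (ε / 2) * M / (12 * L) := by
  have hmR : (1 : ℝ) ≤ m := by exact_mod_cast hm
  refine two_mul_chainingBound_le hγ hε (by linarith) hM hb hHb hH ?_
  have hx : (1 + (2 ^ (l + 1) : ℕ) : ℝ) ≤ 3 * (v * M ^ 2) := by
    have hpow : (1 : ℝ) ≤ 2 ^ l := one_le_pow₀ one_le_two
    push_cast
    rw [pow_succ]
    linarith
  have hlog := log_three_thousand_mul_add_le hL (show (0 : ℝ) < m by linarith) hHb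
  have hlog0 : 0 ≤ Real.log (3000 * m) + 2 * H :=
    add_nonneg (Real.log_nonneg (by linarith)) (by positivity)
  calc (104448 * γ * b * L ^ 2) ^ 2 *
        (132 * k * (1 + (2 ^ (l + 1) : ℕ)) * (Real.log (3000 * m) + 2 * H))
      ≤ (104448 * γ * b * L ^ 2) ^ 2 *
        (132 * k * (3 * (v * M ^ 2)) * (Real.log m + (9 + 2 * b) * L)) := by gcongr
    _ = ε ^ 2 * M ^ 2 * (396 * (104448 * γ * b) ^ 2 * (k / ε ^ 2) * v * L ^ 4 *
          (Real.log m + (9 + 2 * b) * L)) := by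
        field_simp
        ring
    _ ≤ ε ^ 2 * M ^ 2 * m := by gcongr
    _ = m * (ε * M) ^ 2 := by ring

/-- The factor of `log (k / ε)` in the number of scales of the chaining argument. -/
noncomputable def depthConst (γ : ℝ) : ℝ :=
  2 * Real.log (13056 * γ) + 5

/-- The factor that makes the increments of the chaining argument sum up to a small fraction of
`m * ε`. -/
noncomputable def widthConst (γ : ℝ) : ℝ :=
  396 * (104448 * γ * depthConst γ) ^ 2

theorem one_le_depthConst {γ : ℝ} (hγ : 1 ≤ γ) : 1 ≤ depthConst γ := by
  unfold depthConst
  linarith [Real.log_nonneg (show 1 ≤ 13056 * γ by linarith)]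

theorem mul_sq_le_widthConst {γ : ℝ} (hγ : 1 ≤ γ) : 73728 * γ ^ 2 ≤ widthConst γ := by
  have hb : 1 ≤ depthConst γ ^ 2 := one_le_pow₀ (one_le_depthConst hγ)
  calc 73728 * γ ^ 2 ≤ 396 * 104448 ^ 2 * γ ^ 2 * 1 := by nlinarith [sq_nonneg γ]
    _ ≤ 396 * 104448 ^ 2 * γ ^ 2 * depthConst γ ^ 2 := by gcongr
    _ = widthConst γ := by
        unfold widthConst
        ring

theorem one_le_widthConst {γ : ℝ} (hγ : 1 ≤ γ) : 1 ≤ widthConst γ :=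
  le_trans (by nlinarith) (mul_sq_le_widthConst hγ)

/-- The factor by which the number of samples exceeds the width of the chaining argument; it pays
for the logarithm of the number of samples. -/
noncomputable def logConst (γ : ℝ) : ℝ :=
  16 + 2 * (Real.log (widthConst γ) + 9 + (9 + 2 * depthConst γ))

theorem one_le_logConst {γ : ℝ} (hγ : 1 ≤ γ) : 1 ≤ logConst γ := by
  unfold logConst
  linarith [Real.log_nonneg (one_le_widthConst hγ), one_le_depthConst hγ]

theorem exists_forall_chainingBound_le {γ D β ε : ℝ} {k m : ℕ} (hγ : 1 ≤ γ) (hD : 1 ≤ D)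
    (hk : 1 ≤ k) (hβ : 0 < β) (hε : 0 < ε) (hε1 : ε < 1) (hm : 0 < m)
    (hwidth : widthConst γ * (k / ε ^ 2) * min (2 * D * max 1 (1 / β)) (k + 1) *
      (1 + Real.log (k / ε)) ^ 4 * (logConst γ * (1 + Real.log (k / ε))) ≤ m) :
    ∃ H : ℕ, ∀ l : ℕ, 2 ^ l ≤ k + 1 →
      2 * chainingBound (4 * γ) k m (2 ^ (l + 1)) H ≤
        m * (ε / 2) * growthFactor β D l / (6 * (Nat.log 2 (k + 1) + 1 : ℕ)) := by
  have hkR : (1 : ℝ) ≤ k := by exact_mod_cast hk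
  have hL := one_le_one_add_log_div hkR hε hε1
  have hb := one_le_depthConst hγ
  have hv : 1 ≤ min (2 * D * max 1 (1 / β)) (k + 1 : ℝ) :=
    le_min (one_le_mul_of_one_le_of_one_le (by linarith) (le_max_left _ _)) (by linarith)
  have hmlog := width_mul_log_add_le (a := 9 + 2 * depthConst γ) hkR hε hε1 (by linarith)
    (one_le_widthConst hγ) hv ((min_le_right _ _).trans (by linarith)) hwidth
  obtain ⟨H, hH, (hHb : (H : ℝ) ≤ depthConst γ * _)⟩ :=
    exists_chaining_depth hkR hε hε1 (show 1 ≤ 13056 * γ by linarith)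
  refine ⟨H, fun l hl => ?_⟩
  have hM := one_le_growthFactor β D l
  have hl' : (2 : ℝ) ^ l ≤ k + 1 := by exact_mod_cast hl
  have hlv : (2 : ℝ) ^ l ≤ min (2 * D * max 1 (1 / β)) (k + 1) * growthFactor β D l ^ 2 := by
    rw [min_mul_of_nonneg _ _ (by positivity)]
    exact le_min (two_pow_le_mul_growthFactor_sq hβ hD l)
      (hl'.trans (le_mul_of_one_le_right (by positivity) (one_le_pow₀ hM)))
  refine (two_mul_chainingBound_two_pow_le (by linarith) hε hL hM (by linarith) (by linarith) hm
    hHb hH hlv hmlog).trans (div_le_div_of_nonneg_left (by positivity) (by positivity) ?_)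
  linarith [natLog_add_one_le hk, log_le_log_div hkR hε hε1]

theorem exists_sample_size_constant {γ D : ℝ} (hγ : 1 ≤ γ) (hD : 1 ≤ D) :
    ∃ C : ℝ, 0 < C ∧ ∀ (k m : ℕ) (β ε : ℝ), 1 ≤ k → 0 < β → 0 < ε → ε < 1 →
      C * ((k : ℝ) / ε ^ 2 * max 1 (1 / β)) * (1 + Real.log ((k : ℝ) / ε)) ^ 5 ≤ (m : ℝ) →
      k ≤ m ∧ 32 * k * Real.log (2 * k) ≤ (ε / (2 * (1 + γ)) / 12) ^ 2 * m ∧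
      ∃ H : ℕ, ∀ l : ℕ, 2 ^ l ≤ k + 1 →
        2 * chainingBound (4 * γ) k m (2 ^ (l + 1)) H ≤
          m * (ε / 2) * growthFactor β D l / (6 * (Nat.log 2 (k + 1) + 1 : ℕ)) := by
  have hc := one_le_widthConst hγ
  have hF := one_le_logConst hγ
  refine ⟨widthConst γ * (2 * D) * logConst γ, by positivity, fun k m β ε hk hβ hε hε1 hm => ?_⟩
  have hkR : (1 : ℝ) ≤ k := by exact_mod_cast hk
  have hkL := log_le_log_div hkR hε hε1
  have hL := one_le_one_add_log_div hkR hε hε1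
  set L := 1 + Real.log (k / ε)
  have hv : 1 ≤ min (2 * D * max 1 (1 / β)) (k + 1 : ℝ) :=
    le_min (one_le_mul_of_one_le_of_one_le (by linarith) (le_max_left _ _)) (by linarith)
  have hwidth : widthConst γ * (k / ε ^ 2) * min (2 * D * max 1 (1 / β)) (k + 1) * L ^ 4 *
      (logConst γ * L) ≤ m := by
    calc _ ≤ widthConst γ * (k / ε ^ 2) * (2 * D * max 1 (1 / β)) * L ^ 4 *
          (logConst γ * L) := by
          gcongr
          exact min_le_left _ _
      _ = widthConst γ * (2 * D) * logConst γ * (k / ε ^ 2 * max 1 (1 / β)) * L ^ 5 := by ring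
      _ ≤ m := hm
  have hbase : widthConst γ * (k / ε ^ 2) * L ≤ m := by
    calc widthConst γ * (k / ε ^ 2) * L
        = widthConst γ * (k / ε ^ 2) * 1 * 1 * (1 * L) := by ring
      _ ≤ _ := by
          gcongr
          exact one_le_pow₀ hL
      _ ≤ m := hwidth
  have hkm : (k : ℝ) ≤ m := by
    calc (k : ℝ) ≤ k / ε ^ 2 := le_div_self (by positivity) (by positivity) (by nlinarith)
      _ = 1 * (k / ε ^ 2) * 1 := by ring
      _ ≤ widthConst γ * (k / ε ^ 2) * L := by gcongr
      _ ≤ m := hbase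
  have hkm' : k ≤ m := by exact_mod_cast hkm
  exact ⟨hkm', cluster_size_condition hγ hε (by linarith) (by linarith) (by linarith)
    (mul_sq_le_widthConst hγ) hbase,
    exists_forall_chainingBound_le hγ hD hk hβ hε hε1 (by omega) hwidth⟩

end Arithmetic

section Success

variable {d k m : ℕ} {P : Finset (Pt d)} {A : Fin k → Pt d} {σ : Pt d → Fin k}

theorem relCost_eq_zero (hσ : IsNearest P A σ) (hA : cost P A = 0) {p : Pt d} (hp : p ∈ P)
    (S : Fin k → Pt d) : relCost (A (σ p)) p S = 0 := by
  have : NeZero k := NeZero.of_pos (σ p).pos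
  have hpA : ptCost p A ≤ cost P A :=
    Finset.single_le_sum (f := fun p => ptCost p A) (fun x _ => ptCost_nonneg x A) hp
  have hrel := abs_relCost_le (A (σ p)) p S
  rw [← ptCost_eq_of_isNearest hσ hp] at hrel
  exact abs_nonpos_iff.mp (hrel.trans (hpA.trans hA.le))

theorem badCosts_eq_empty_of_cost_eq_zero (hσ : IsNearest P A σ) (hA : cost P A = 0) {ε : ℝ}
    (hε : 0 ≤ ε) (𝒞 : Set (Fin k → Pt d)) : badCosts P A σ m ε 𝒞 = ∅ := by
  refine Set.eq_empty_of_forall_notMem ?_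
  rintro q ⟨S, -, hS⟩
  have hcost := cost_nonneg P S
  have hzero : samplingError A σ q (fun p => relCost (A (σ p)) p S) = 0 := by
    rw [samplingError_congr q fun p hp => relCost_eq_zero hσ hA hp S]
    simp [samplingError]
  rw [hzero, abs_zero] at hS
  exact hS.not_ge (by positivity)

theorem opt_mul_growthFactor_le_cost {γ β : ℝ} (hγ : 0 ≤ γ) (hβ : 0 ≤ β) (hst : IsStable P k β)
    (hσ : IsNearest P A σ) (hA : IsApprox γ P A) {S : Fin k → Pt d} {l : ℕ}
    (hl : 2 ^ l ≤ (ambiguous A S).card + 1) :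
    opt P k * growthFactor β (8 * (3 + 4 * γ)) l ≤ cost P S := by
  have hopt := opt_le_cost P S
  have hopt0 := opt_nonneg P k
  have hcostA : cost P A ≤ γ * cost P S := hA.trans (mul_le_mul_of_nonneg_left hopt hγ)
  have hl' : (2 : ℝ) ^ l - 1 ≤ (ambiguous A S).card := by
    rw [sub_le_iff_le_add]
    exact_mod_cast hl
  rw [growthFactor, mul_max_of_nonneg _ _ hopt0, mul_one]
  refine max_le hopt ?_
  calc opt P k * ((2 ^ l - 1) * (β / (8 * (3 + 4 * γ))))
      = (2 ^ l - 1) * (β * opt P k) / (8 * (3 + 4 * γ)) := by ring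
    _ ≤ (ambiguous A S).card * (β * opt P k) / (8 * (3 + 4 * γ)) := by gcongr
    _ ≤ 8 * (3 * cost P S + 4 * cost P A) / (8 * (3 + 4 * γ)) :=
        div_le_div_of_nonneg_right (card_ambiguous_mul_opt_le hβ hst hσ S) (by positivity)
    _ ≤ cost P S := by
        rw [div_le_iff₀ (by positivity)]
        linarith

/-- The solutions `S` whose number of ambiguous clusters plus one lies in `[2 ^ l, 2 ^ (l + 1))`.
The chaining bound is applied to each of these classes separately. -/
def ambiguityClass (A : Fin k → Pt d) (l : ℕ) : Set (Fin k → Pt d) :=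
  {S | Nat.log 2 ((ambiguous A S).card + 1) = l}

theorem mem_ambiguityClass_iff {S : Fin k → Pt d} {l : ℕ} :
    S ∈ ambiguityClass A l ↔
      2 ^ l ≤ (ambiguous A S).card + 1 ∧ (ambiguous A S).card + 1 < 2 ^ (l + 1) :=
  Nat.log_eq_iff (Or.inr ⟨one_lt_two, Nat.succ_ne_zero _⟩)

theorem badCosts_univ_subset (P : Finset (Pt d)) (A : Fin k → Pt d) (σ : Pt d → Fin k) (m : ℕ)
    (ε : ℝ) :
    badCosts P A σ m ε Set.univ ⊆
      ⋃ l ∈ Finset.range (Nat.log 2 (k + 1) + 1), badCosts P A σ m ε (ambiguityClass A l) := by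
  rintro q ⟨S, -, hS⟩
  have hcard : (ambiguous A S).card ≤ k := by simpa using (ambiguous A S).card_le_univ
  exact Set.mem_biUnion
    (Finset.mem_range_succ_iff.mpr (Nat.log_mono_right (Nat.add_le_add_right hcard 1)))
    ⟨S, rfl, hS⟩

theorem measureReal_badCosts_ambiguityClass_le (hP : P.Nonempty) (hσ : IsNearest P A σ)
    {γ β ε τ : ℝ} (hγ : 0 ≤ γ) (hβ : 0 ≤ β) (hε : 0 < ε) (hst : IsStable P k β)
    (hA : IsApprox γ P A) (hcA : 0 < cost P A) (hm : 0 < m) (hkm : k ≤ m) {H l : ℕ}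
    (hH : 2 * chainingBound (4 * γ) k m (2 ^ (l + 1)) H ≤
      m * (ε / 2) * growthFactor β (8 * (3 + 4 * γ)) l / τ) :
    (sampleLaw P hP A σ m).real (badCosts P A σ m ε (ambiguityClass A l)) ≤ 1 / τ := by
  have hopt : 0 < opt P k := pos_of_mul_pos_right (hcA.trans_le hA) hγ
  set M := growthFactor β (8 * (3 + 4 * γ)) l
  have hM : 1 ≤ M := one_le_growthFactor _ _ _
  have hmarkov := mul_measureReal_badCosts_le (m := m) (σ := σ) (ε := ε) (K := opt P k * M)
    (𝒞 := ambiguityClass A l) hP hσ hcA hkm (2 ^ (l + 1)) hε (by positivity)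
    (fun S hS => (Nat.lt_of_succ_lt (mem_ambiguityClass_iff.mp hS).2).le)
    (fun S hS => opt_mul_growthFactor_le_cost hγ hβ hst hσ hA (mem_ambiguityClass_iff.mp hS).1) H
  have hscale : chainingBound (4 * cost P A) k m (2 ^ (l + 1)) H ≤
      opt P k * chainingBound (4 * γ) k m (2 ^ (l + 1)) H := by
    rw [← chainingBound_mul]
    refine chainingBound_mono ?_ _ _ _ _
    linarith [show cost P A ≤ γ * opt P k from hA]
  refine le_of_mul_le_mul_left ?_ (show 0 < m * (ε / 2) * (opt P k * M) by positivity)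
  calc _ ≤ 2 * chainingBound (4 * cost P A) k m (2 ^ (l + 1)) H := hmarkov
    _ ≤ opt P k * (2 * chainingBound (4 * γ) k m (2 ^ (l + 1)) H) := by linarith
    _ ≤ opt P k * (m * (ε / 2) * M / τ) := by gcongr
    _ = m * (ε / 2) * (opt P k * M) * (1 / τ) := by ring

theorem measureReal_badCosts_univ_le (hP : P.Nonempty) (hσ : IsNearest P A σ) {γ β ε : ℝ}
    (hγ : 0 ≤ γ) (hβ : 0 ≤ β) (hε : 0 < ε) (hst : IsStable P k β) (hA : IsApprox γ P A)
    (hm : 0 < m) (hkm : k ≤ m) {H : ℕ}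
    (hH : ∀ l : ℕ, 2 ^ l ≤ k + 1 → 2 * chainingBound (4 * γ) k m (2 ^ (l + 1)) H ≤
      m * (ε / 2) * growthFactor β (8 * (3 + 4 * γ)) l / (6 * (Nat.log 2 (k + 1) + 1 : ℕ))) :
    (sampleLaw P hP A σ m).real (badCosts P A σ m ε Set.univ) ≤ 1 / 6 := by
  rcases (cost_nonneg P A).eq_or_lt' with hcA | hcA
  · rw [badCosts_eq_empty_of_cost_eq_zero hσ hcA hε.le, measureReal_empty]
    norm_num
  have hclass : ∀ l ∈ Finset.range (Nat.log 2 (k + 1) + 1),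
      (sampleLaw P hP A σ m).real (badCosts P A σ m ε (ambiguityClass A l)) ≤
        1 / (6 * (Nat.log 2 (k + 1) + 1 : ℕ)) := fun l hl =>
    measureReal_badCosts_ambiguityClass_le hP hσ hγ hβ hε hst hA hcA hm hkm
      (hH l (Nat.pow_le_of_le_log k.succ_ne_zero (Finset.mem_range_succ_iff.mp hl)))
  calc (sampleLaw P hP A σ m).real (badCosts P A σ m ε Set.univ)
      ≤ ∑ l ∈ Finset.range (Nat.log 2 (k + 1) + 1),
          (sampleLaw P hP A σ m).real (badCosts P A σ m ε (ambiguityClass A l)) :=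
        (measureReal_mono (badCosts_univ_subset P A σ m ε) (measure_ne_top _ _)).trans
          (measureReal_biUnion_finset_le _ _)
    _ ≤ ∑ _l ∈ Finset.range (Nat.log 2 (k + 1) + 1),
          1 / (6 * ((Nat.log 2 (k + 1) + 1 : ℕ) : ℝ)) :=
        Finset.sum_le_sum hclass
    _ = 1 / 6 := by
        rw [Finset.sum_const, Finset.card_range, nsmul_eq_mul]
        field_simp

theorem two_thirds_le_measureReal_isCoreset (hP : P.Nonempty) (hσ : IsNearest P A σ) (hm : 0 < m)
    {ε γ : ℝ} (hε : 0 ≤ ε) (hγ : 0 ≤ γ) (hA : IsApprox γ P A)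
    (hsizes : (sampleLaw P hP A σ m).real (badSizes P A σ m (ε / (2 * (1 + γ)))) ≤ 1 / 6)
    (hcosts : (sampleLaw P hP A σ m).real (badCosts P A σ m ε Set.univ) ≤ 1 / 6) :
    2 / 3 ≤ (sampleLaw P hP A σ m).real
      {q | IsCoreset P k ε (fun i => (q i : Pt d)) (fun i => sampleWeight P A σ m (q i))} := by
  set good := {q : Fin m → {x // x ∈ P} |
    IsCoreset P k ε (fun i => (q i : Pt d)) (fun i => sampleWeight P A σ m (q i))}
  have hcover : Set.univ ⊆
      good ∪ (badSizes P A σ m (ε / (2 * (1 + γ))) ∪ badCosts P A σ m ε Set.univ) := by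
    intro q _
    by_contra h
    simp only [Set.mem_union, not_or] at h
    exact h.1 (isCoreset_of_notMem hσ hm hε hγ hA h.2.1 h.2.2)
  have hone := measureReal_mono (μ := sampleLaw P hP A σ m) hcover
  rw [probReal_univ] at hone
  have hunion := measureReal_union_le (μ := sampleLaw P hP A σ m) good
    (badSizes P A σ m (ε / (2 * (1 + γ))) ∪ badCosts P A σ m ε Set.univ)
  have hbad := measureReal_union_le (μ := sampleLaw P hP A σ m)
    (badSizes P A σ m (ε / (2 * (1 + γ)))) (badCosts P A σ m ε Set.univ)
  linarith

end Success

end KMedian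

theorem mainTheorem5 (γ : ℝ) (hγ : 1 ≤ γ) :
    ∃ C : ℝ, 0 < C ∧ ∃ c : ℕ,
      ∀ (d k : ℕ), 1 ≤ k →
      ∀ (P : Finset (KMedian.Pt d)) (hP : P.Nonempty) (β : ℝ), 0 < β → KMedian.IsStable P k β →
      ∀ ε : ℝ, 0 < ε → ε < 1 →
      ∀ A : Fin k → KMedian.Pt d, KMedian.IsApprox γ P A →
      ∀ σ : KMedian.Pt d → Fin k, KMedian.IsNearest P A σ →
      ∀ m : ℕ,
        C * ((k : ℝ) / ε ^ 2 * max 1 (1 / β)) * (1 + Real.log ((k : ℝ) / ε)) ^ c ≤ (m : ℝ) →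
        2 / 3 ≤ (KMedian.sampleLaw P hP A σ m).real
          {q | KMedian.IsCoreset P k ε (fun i => (q i : KMedian.Pt d))
            (fun i => KMedian.sampleWeight P A σ m (q i))} := by
  obtain ⟨C, hC, hsize⟩ :=
    KMedian.exists_sample_size_constant hγ (show 1 ≤ 8 * (3 + 4 * γ) by linarith)
  refine ⟨C, hC, 5, fun d k hk P hP β hβ hst ε hε hε1 A hA σ hσ m hm => ?_⟩
  obtain ⟨hkm, hη, H, hH⟩ := hsize k m β ε hk hβ hε hε1 hm
  have hm0 : 0 < m := hk.trans hkm
  have hγ0 : 0 ≤ γ := zero_le_one.trans hγ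
  have hη1 : ε / (2 * (1 + γ)) ≤ 1 := div_le_one_of_le₀ (by linarith) (by positivity)
  have hsizes := KMedian.measureReal_badSizes_le (A := A) (σ := σ) hP hm0 (by positivity) hη1 hη
  have hcosts := KMedian.measureReal_badCosts_univ_le hP hσ hγ0 hβ.le hε hst hA hm0 hkm hH
  exact KMedian.two_thirds_le_measureReal_isCoreset hP hσ hm0 hε.le hγ0 hA hsizes hcosts
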